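/- Let $Y$ be a real random variable, $X_{nc}$ a random vector in $\mathbb{R}^p$ ($p\ge 1$) and $X_c$ a random vector in $\mathbb{R}^d$, such that only the distributions of $(Y,X_c)$ and of $(X_{nc},X_c)$ are known. Let $T=\mathrm{Supp}(X_c)$ and fix versions of the conditional distributions of $Y$ and of $X_{nc}$ given $X_c=x$; conditional quantities given $X_c=x$ are computed from these versions. Suppose that $E(Y^2)<\infty$ and that, for all $x\in T$, $E(|Y|\,|X_c=x)<\infty$, $E(\|X_{nc}\|^2|X_c=x)<\infty$ and, with $m_Y(x)=E(Y|X_c=x)$, $m_X(x)=E(X_{nc}|X_c=x)$, $Y^x=Y-m_Y(x)$ and $X^x=X_{nc}-m_X(x)$, the matrix $E(X^xX^{x\prime}|X_c=x)$ is nonsingular. Let $R$ be a linear operator from a vector space $\mathcal{D}$ of real functions on $T$ to the real functions on a set $\mathcal{R}$, with $m_Y\in\mathcal{D}$ and $m_X'q\in\mathcal{D}$ for all $q\in\mathbb{R}^p$, and let $c:\mathcal{R}\to\mathbb{R}$. Call $(\beta,f)$, with $\beta\in\mathbb{R}^p$ and $f:T\to\mathbb{R}$, admissible if $f\in\mathcal{D}$,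 $[Rf](r)\ge c(r)$ for all $r\in\mathcal{R}$, and there is a random vector $(\tilde Y,\tilde X_{nc},\tilde X_c)$ such that $\tilde X_c$ has the distribution of $X_c$ and which has a version of the conditional distribution of $(\tilde Y,\tilde X_{nc})$ given $\tilde X_c$ such that, for all $x\in T$, the conditional distributions of $\tilde Y$ and of $\tilde X_{nc}$ given $\tilde X_c=x$ are those of $Y$ and of $X_{nc}$ given $X_c=x$, and $E(\tilde Y|\tilde X_{nc},\tilde X_c=x)=f(x)+\tilde X_{nc}'\beta$. The identified sets of $\beta_0$ and $f$ under the partially linear model $E(Y|X_{nc},X_c)=f(X_c)+X_{nc}'\beta_0$ and the restrictions $[Rf](r)\ge c(r)$ are $\mathcal{B}^{con}=\{\beta:\exists f,\ (\beta,f)\text{ admissible}\}$ and $\mathcal{F}^{con}=\{f:\exists\beta,\ (\beta,f)\text{ admissible}\}$. For cdfs $F,G$ with mean zero let $S(F,G)=\inf_{\alpha\in(0,1)}\int_\alpha^1F^{-1}(t)dt\big/\int_\alpha^1G^{-1}(t)dt$, where $F^{-1}(t)=\inf\{x:F(x)\ge t\}$, and for $q\in\mathbb{R}^p$ let $\overline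 S(q)=\inf_{x\in T}S(F_{Y^x|X_c=x},F_{X^{x\prime}q|X_c=x})$ and $$\underline S^c(q)=\sup_{r:\,[Rm_X'q](r)\le0}\ \lim_{u\downarrow0}\frac{[Rm_Y-c](r)+u}{[Rm_X'q](r)-u^2},\qquad \overline S^c(q)=\inf_{r:\,[Rm_X'q](r)\ge0}\ \lim_{u\downarrow0}\frac{[Rm_Y-c](r)+u}{[Rm_X'q](r)+u^2},$$ with values in $[-\infty,\infty]$, $\sup\emptyset=-\infty$ and $\inf\emptyset=+\infty$. Then $$\mathcal{B}^{con}=\left\{\lambda q:\ \|q\|=1,\ q_1\ge0,\ \lambda\in\mathbb{R},\ \max\big(-\overline S(-q),\underline S^c(q)\big)\le\lambda\le\min\big(\overline S(q),\overline S^c(q)\big)\right\},$$ $$\mathcal{F}^{con}=\left\{x\mapsto m_Y(x)-m_X(x)'\beta:\ \beta\in\mathcal{B}^{con}\right\}.$$ Moreover $\mathcal{B}^{con}$ is compact and convex, and $0\notin\mathcal{B}^{con}$ if $[Rm_Y-c](r)<0$ for some $r\in\mathcal{R}$. -/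

import Mathlib

open MeasureTheory ProbabilityTheory Filter Topology Set

namespace DataCombination

noncomputable section

/-- The generalized inverse `F⁻¹(t) = inf {x : F x ≥ t}` of a cdf. -/
def genInv (F : ℝ → ℝ) (t : ℝ) : ℝ := sInf {x : ℝ | t ≤ F x}

/-- The ratio of superquantiles `R(α, F, G) = ∫_α^1 F⁻¹ / ∫_α^1 G⁻¹`. -/
def ratioR (α : ℝ) (F G : ℝ → ℝ) : ℝ :=
  (∫ t in α..1, genInv F t) / (∫ t in α..1, genInv G t)

/-- `S(F, G) = inf_{α ∈ (0,1)} R(α, F, G)`. -/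
def radialS (F G : ℝ → ℝ) : EReal := ⨅ α ∈ Ioo (0 : ℝ) 1, (ratioR α F G : EReal)

section Model

variable {d p : ℕ}

/-- `m_Y(x) = E(Y | X_c = x)`, where `κY x` is the law of `Y` given `X_c = x`. -/
def meanY (κY : Kernel (EuclideanSpace ℝ (Fin d)) ℝ) (x : EuclideanSpace ℝ (Fin d)) : ℝ :=
  ∫ y, y ∂(κY x)

/-- `m_{X_nc}(x) = E(X_nc | X_c = x)`, where `κX x` is the law of `X_nc` given `X_c = x`. -/
def meanX (κX : Kernel (EuclideanSpace ℝ (Fin d)) (EuclideanSpace ℝ (Fin p)))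
    (x : EuclideanSpace ℝ (Fin d)) : EuclideanSpace ℝ (Fin p) :=
  ∫ z, z ∂(κX x)

/-- The matrix `E(X^x X^x' | X_c = x)`, where `X^x = X_nc - E(X_nc | X_c = x)`. -/
def condVarX (κX : Kernel (EuclideanSpace ℝ (Fin d)) (EuclideanSpace ℝ (Fin p)))
    (x : EuclideanSpace ℝ (Fin d)) : Matrix (Fin p) (Fin p) ℝ :=
  Matrix.of fun i j => ∫ z, (z - meanX κX x) i * (z - meanX κX x) j ∂(κX x)

/-- The cdf of `Y^x = Y - E(Y | X_c = x)` given `X_c = x`. -/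
def cdfResidY (κY : Kernel (EuclideanSpace ℝ (Fin d)) ℝ) (x : EuclideanSpace ℝ (Fin d)) :
    ℝ → ℝ :=
  fun t => cdf ((κY x).map (fun y => y - meanY κY x)) t

/-- The cdf of `X^x' q` given `X_c = x`, where `X^x = X_nc - E(X_nc | X_c = x)`. -/
def cdfResidX (κX : Kernel (EuclideanSpace ℝ (Fin d)) (EuclideanSpace ℝ (Fin p)))
    (q : EuclideanSpace ℝ (Fin p)) (x : EuclideanSpace ℝ (Fin d)) : ℝ → ℝ :=
  fun t => cdf ((κX x).map (fun z => inner ℝ (z - meanX κX x) q)) t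

/-- `inf_{x ∈ Supp(X_c)} S(F_{Y^x | X_c = x}, F_{X^x' q | X_c = x})`, with `T = Supp(X_c)`. -/
def radialSbar (T : Set (EuclideanSpace ℝ (Fin d)))
    (κY : Kernel (EuclideanSpace ℝ (Fin d)) ℝ)
    (κX : Kernel (EuclideanSpace ℝ (Fin d)) (EuclideanSpace ℝ (Fin p)))
    (q : EuclideanSpace ℝ (Fin p)) : EReal :=
  ⨅ x ∈ T, radialS (cdfResidY κY x) (cdfResidX κX q x)

/-- The pair `(β, f)` is compatible with the partially linear model and with the distributions of
`(Y, X_c)` and `(X_nc, X_c)`: there is a random vector `(Ỹ, X̃_nc, X̃_c)`, with `X̃_c` distributed as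
`X_c` and with conditional law `κ x` of `(Ỹ, X̃_nc)` given `X̃_c = x` (so that its joint law is the
law of `X_c` composed with the Markov kernel `κ`), such that, for every `x` in `T = Supp(X_c)`, the
laws of `Ỹ` and of `X̃_nc` given `X̃_c = x` are those of `Y` and of `X_nc` given `X_c = x`, and
`E(Ỹ | X̃_nc, X̃_c = x) = f x + X̃_nc' β`. -/
def Compatible (T : Set (EuclideanSpace ℝ (Fin d)))
    (κY : Kernel (EuclideanSpace ℝ (Fin d)) ℝ)
    (κX : Kernel (EuclideanSpace ℝ (Fin d)) (EuclideanSpace ℝ (Fin p)))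
    (β : EuclideanSpace ℝ (Fin p)) (f : T → ℝ) : Prop :=
  ∃ κ : Kernel (EuclideanSpace ℝ (Fin d)) (ℝ × EuclideanSpace ℝ (Fin p)), IsMarkovKernel κ ∧
    ∀ x : T, (κ x).map Prod.fst = κY x ∧ (κ x).map Prod.snd = κX x ∧
      (κ x)[Prod.fst | MeasurableSpace.comap Prod.snd inferInstance]
        =ᵐ[κ x] fun w => f x + inner ℝ w.2 β

/-- `f` satisfies the shape restrictions: it lies in the domain `D` of `R`, and
`[R f](r) ≥ c(r)` for all `r`. -/
def SatisfiesShape {T : Set (EuclideanSpace ℝ (Fin d))} {I : Type*} (D : Submodule ℝ (T → ℝ))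
    (R : D →ₗ[ℝ] (I → ℝ)) (c : I → ℝ) (f : T → ℝ) : Prop :=
  ∃ hf : f ∈ D, ∀ r, c r ≤ R ⟨f, hf⟩ r

/-- The identified set of `β₀` under the shape restrictions. -/
def identifiedBeta (T : Set (EuclideanSpace ℝ (Fin d)))
    (κY : Kernel (EuclideanSpace ℝ (Fin d)) ℝ)
    (κX : Kernel (EuclideanSpace ℝ (Fin d)) (EuclideanSpace ℝ (Fin p)))
    {I : Type*} (D : Submodule ℝ (T → ℝ)) (R : D →ₗ[ℝ] (I → ℝ)) (c : I → ℝ) :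
    Set (EuclideanSpace ℝ (Fin p)) :=
  {β | ∃ f : T → ℝ, Compatible T κY κX β f ∧ SatisfiesShape D R c f}

/-- The identified set of `f` (as a function on `T = Supp(X_c)`) under the shape restrictions. -/
def identifiedF (T : Set (EuclideanSpace ℝ (Fin d)))
    (κY : Kernel (EuclideanSpace ℝ (Fin d)) ℝ)
    (κX : Kernel (EuclideanSpace ℝ (Fin d)) (EuclideanSpace ℝ (Fin p)))
    {I : Type*} (D : Submodule ℝ (T → ℝ)) (R : D →ₗ[ℝ] (I → ℝ)) (c : I → ℝ) :
    Set (T → ℝ) :=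
  {f | ∃ β : EuclideanSpace ℝ (Fin p), Compatible T κY κX β f ∧ SatisfiesShape D R c f}

end Model

/-- `sup_{r : b r ≤ 0} lim_{u ↓ 0} (a r + u) / (b r - u²)`, with limits in `[-∞, ∞]` and
`sup ∅ = -∞`. It is used with `a = R m_Y - c` and `b = R (m_{X_nc}' q)`. -/
def lowerSc {I : Type*} (a b : I → ℝ) : EReal :=
  ⨆ (r : I) (_ : b r ≤ 0),
    limUnder (𝓝[>] (0 : ℝ)) (fun u : ℝ => (((a r + u) / (b r - u ^ 2) : ℝ) : EReal))

/-- `inf_{r : b r ≥ 0} lim_{u ↓ 0} (a r + u) / (b r + u²)`, with limits in `[-∞, ∞]` and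
`inf ∅ = ∞`. It is used with `a = R m_Y - c` and `b = R (m_{X_nc}' q)`. -/
def upperSc {I : Type*} (a b : I → ℝ) : EReal :=
  ⨅ (r : I) (_ : 0 ≤ b r),
    limUnder (𝓝[>] (0 : ℝ)) (fun u : ℝ => (((a r + u) / (b r + u ^ 2) : ℝ) : EReal))

end

end DataCombination

namespace DataCombination

/-! For fixed `x`, averaging the model over `X̃_nc` forces `f x = m_Y(x) - m_X(x)'β`. Once this is
imposed, compatibility at `x` asks for a coupling of `Y^x` and `X^x` with `E(Y^x | X^x) = X^x'β`. By
conditional Jensen, such a coupling requires `E(X^x'β - k)⁺ ≤ E(Y^x - k)⁺` for every `k`; this is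
the convex order between two centered laws. By the Rockafellar–Uryasev formula it implies the order
between superquantiles. Conversely, superquantile order gives a martingale coupling of `X^x'β` and
`Y^x` (Strassen), and gluing it with the law of `X^x` produces the required law. Since the coupling
has to be a kernel in `x`, Strassen's theorem is proved constructively, with explicit formulas in
the quantile functions that are visibly measurable in the parameter (`exists_martingale_kernel`,
`exists_glued_kernel`, `compatible_of_superquantile`).

The three forms of compatibility are then used where each is convenient (`compatible_tfae`).
Superquantiles are positively homogeneous in `β`, so along a half-line their order reads `λ ≤
S̄(q)`, and the opposite half-line is handled by `-q` (`radial_iff`). The shape restriction becomes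
`λ [R m_X'q](r) ≤ [R m_Y - c](r)` for all `r`, and the perturbations `u`, `u²` encode the case of a
zero coefficient (`lowerSc_le_and_le_upperSc_iff`).

In call form, the identified set is an intersection of sublevel sets of finite convex functions of
`β` and of half-spaces, hence closed and convex. It is bounded because `E(X^x'β)⁺` is positively
homogeneous and positive off the origin when the conditional variance is nonsingular. -/

/-- The uniform distribution on `(0, 1)`. -/
noncomputable abbrev unif : Measure ℝ := volume.restrict (Ioo (0 : ℝ) 1)

instance : IsProbabilityMeasure unif := ⟨by simp [unif]⟩

/-! ### Quantile functions, superquantiles and call functions -/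

section Quantile

variable (μ : Measure ℝ)

/-- The Galois connection behind all quantile arguments. Right continuity of the cdf puts the
infimum in the set; `0 < t < 1` makes the set bounded below and nonempty, so that `sInf` takes no
default value. -/
lemma genInv_cdf_le_iff {t : ℝ} (ht : t ∈ Ioo (0 : ℝ) 1) (x : ℝ) :
    genInv (cdf μ) t ≤ x ↔ t ≤ cdf μ x := by
  have hbdd : BddBelow {x : ℝ | t ≤ cdf μ x} := by
    obtain ⟨b, hb⟩ := ((tendsto_cdf_atBot μ).eventually (gt_mem_nhds ht.1)).exists
    refine ⟨b, fun y hy => ?_⟩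
    by_contra h
    exact absurd (lt_of_le_of_lt (monotone_cdf μ (not_le.1 h).le) hb) (not_lt.2 hy)
  have hne : {x : ℝ | t ≤ cdf μ x}.Nonempty := by
    obtain ⟨b, hb⟩ := ((tendsto_cdf_atTop μ).eventually (lt_mem_nhds ht.2)).exists
    exact ⟨b, hb.le⟩
  refine ⟨fun h => ?_, fun h => csInf_le hbdd h⟩
  have hev : ∀ᶠ y in 𝓝[>] x, t ≤ cdf μ y := by
    filter_upwards [self_mem_nhdsWithin] with y hy
    obtain ⟨z, hz, hzy⟩ := exists_lt_of_csInf_lt hne (lt_of_le_of_lt h hy)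
    exact le_trans hz (monotone_cdf μ hzy.le)
  have hc : Tendsto (cdf μ) (𝓝[>] x) (𝓝 (cdf μ x)) :=
    ((cdf μ).right_continuous x).tendsto.mono_left (nhdsWithin_mono _ Ioi_subset_Ici_self)
  exact ge_of_tendsto hc hev

lemma monotoneOn_genInv_cdf : MonotoneOn (genInv (cdf μ)) (Ioo 0 1) := by
  intro s hs t ht hst
  rw [genInv_cdf_le_iff μ hs]
  exact hst.trans ((genInv_cdf_le_iff μ ht _).1 le_rfl)

/-- The quantile function on `(0, 1)`, extended by zero. -/
noncomputable def quantile (μ : Measure ℝ) (t : ℝ) : ℝ :=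
  (Ioo (0 : ℝ) 1).indicator (genInv (cdf μ)) t

variable {μ} in
lemma quantile_of_mem {t : ℝ} (ht : t ∈ Ioo (0 : ℝ) 1) : quantile μ t = genInv (cdf μ) t :=
  indicator_of_mem ht _

lemma quantile_le_iff {t : ℝ} (ht : t ∈ Ioo (0 : ℝ) 1) (x : ℝ) :
    quantile μ t ≤ x ↔ t ≤ cdf μ x := by
  rw [quantile_of_mem ht, genInv_cdf_le_iff μ ht]

lemma monotoneOn_quantile : MonotoneOn (quantile μ) (Ioo 0 1) := fun s hs t ht hst => by
  rw [quantile_of_mem hs, quantile_of_mem ht]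
  exact monotoneOn_genInv_cdf μ hs ht hst

lemma superquantile_eq {α : ℝ} (hα : α ∈ Ioo (0 : ℝ) 1) :
    ∫ t in α..1, genInv (cdf μ) t = ∫ t in Ioo α 1, quantile μ t := by
  rw [intervalIntegral.integral_of_le hα.2.le, integral_Ioc_eq_integral_Ioo]
  exact setIntegral_congr_fun measurableSet_Ioo fun t ht =>
    (quantile_of_mem ⟨hα.1.trans ht.1, ht.2⟩).symm

variable [IsProbabilityMeasure μ]

/-- Joint measurability in the parameter and the level: the Galois connection turns sublevel sets
into conditions on `cdf (κ a) x`, which is measurable in `a`. -/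
lemma measurable_quantile_kernel {α : Type*} [MeasurableSpace α] (κ : Kernel α ℝ)
    [IsMarkovKernel κ] : Measurable fun p : α × ℝ => quantile (κ p.1) p.2 := by
  refine measurable_of_Iic fun x => ?_
  have h1 : MeasurableSet {p : α × ℝ | p.2 ∈ Ioo (0 : ℝ) 1} := measurable_snd measurableSet_Ioo
  have h2 : MeasurableSet {p : α × ℝ | p.2 ≤ cdf (κ p.1) x} := by
    refine measurableSet_le measurable_snd ?_
    simp_rw [cdf_eq_real]
    exact ((κ.measurable_coe measurableSet_Iic).comp measurable_fst).ennreal_toReal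
  have : (fun p : α × ℝ => quantile (κ p.1) p.2) ⁻¹' Iic x =
      ({p : α × ℝ | p.2 ∈ Ioo (0 : ℝ) 1} ∩ {p : α × ℝ | p.2 ≤ cdf (κ p.1) x}) ∪
      ({p : α × ℝ | p.2 ∈ Ioo (0 : ℝ) 1}ᶜ ∩ {p : α × ℝ | (0 : ℝ) ≤ x}) := by
    ext p
    by_cases hp : p.2 ∈ Ioo (0 : ℝ) 1
    · have := quantile_le_iff (κ p.1) hp x
      simp only [mem_preimage, mem_Iic, this, mem_union, mem_inter_iff, mem_ofPred_eq,
        mem_compl_iff, hp]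
      tauto
    · simp only [mem_preimage, mem_Iic, mem_union, mem_inter_iff, mem_ofPred_eq, mem_compl_iff, hp,
        quantile, indicator_of_notMem, not_false_eq_true]
      tauto
  rw [this]
  exact (h1.inter h2).union (h1.compl.inter (MeasurableSet.const _))

lemma measurable_quantile : Measurable (quantile μ) :=
  (measurable_quantile_kernel (Kernel.const Unit μ)).comp (measurable_prodMk_left (x := ()))

lemma map_quantile : unif.map (quantile μ) = μ := by
  have := Measure.isProbabilityMeasure_map (μ := unif) (measurable_quantile μ).aemeasurable
  refine Measure.ext_of_Iic _ _ fun x => ?_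
  rw [Measure.map_apply (measurable_quantile μ) measurableSet_Iic,
    Measure.restrict_apply (measurable_quantile μ measurableSet_Iic), ← ofReal_cdf]
  have h : quantile μ ⁻¹' Iic x ∩ Ioo 0 1 = Iic (cdf μ x) ∩ Ioo 0 1 := by
    ext t
    simp only [mem_inter_iff, mem_preimage, mem_Iic]
    exact and_congr_left fun ht => quantile_le_iff μ ht x
  have h0 := cdf_nonneg μ x
  have h1 := cdf_le_one μ x
  rw [h]
  refine le_antisymm ?_ ?_
  · calc volume (Iic (cdf μ x) ∩ Ioo 0 1) ≤ volume (Ioc 0 (cdf μ x)) :=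
        measure_mono fun t ht => ⟨ht.2.1, ht.1⟩
      _ = _ := by simp
  · calc ENNReal.ofReal (cdf μ x) = volume (Ioo 0 (cdf μ x)) := by simp
      _ ≤ _ := measure_mono fun t ht => by
        rw [mem_Ioo] at ht
        exact ⟨ht.2.le, ht.1, ht.2.trans_le h1⟩

lemma lintegral_quantile {h : ℝ → ENNReal} (hh : Measurable h) :
    ∫⁻ t, h (quantile μ t) ∂unif = ∫⁻ y, h y ∂μ := by
  conv_rhs => rw [← map_quantile μ]
  rw [lintegral_map hh (measurable_quantile μ)]

lemma integral_quantile {h : ℝ → ℝ} (hh : Measurable h) :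
    ∫ t, h (quantile μ t) ∂unif = ∫ y, h y ∂μ := by
  conv_rhs => rw [← map_quantile μ]
  rw [integral_map (measurable_quantile μ).aemeasurable hh.aestronglyMeasurable]

lemma integrable_quantile {h : ℝ → ℝ} (hh : Measurable h) (hi : Integrable h μ) :
    Integrable (fun t => h (quantile μ t)) unif := by
  rw [← map_quantile μ] at hi
  exact (integrable_map_measure hh.aestronglyMeasurable (measurable_quantile μ).aemeasurable).1 hi

lemma restrict_unif_Ioo {α : ℝ} (hα : α ∈ Ioo (0 : ℝ) 1) :
    unif.restrict (Ioo α 1) = volume.restrict (Ioo α 1) := by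
  rw [Measure.restrict_restrict measurableSet_Ioo,
    inter_eq_left.2 (Ioo_subset_Ioo_left hα.1.le)]

variable {μ}

lemma integrableOn_quantile (hi : Integrable (fun y => y) μ) {α : ℝ} (hα : α ∈ Ioo (0 : ℝ) 1) :
    IntegrableOn (quantile μ) (Ioo α 1) := by
  have := (integrable_quantile μ measurable_id hi).restrict (s := Ioo α 1)
  rwa [restrict_unif_Ioo hα] at this

lemma integrable_call (hi : Integrable (fun y => y) μ) (k : ℝ) :
    Integrable (fun y => max (y - k) 0) μ := (hi.sub (integrable_const k)).pos_part

/-- The easy half of the Rockafellar–Uryasev formula. -/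
lemma superquantile_le (hi : Integrable (fun y => y) μ) {α : ℝ} (hα : α ∈ Ioo (0 : ℝ) 1) (k : ℝ) :
    ∫ t in α..1, genInv (cdf μ) t ≤ (1 - α) * k + ∫ y, max (y - k) 0 ∂μ := by
  rw [superquantile_eq μ hα, ← integral_quantile μ (h := fun y => max (y - k) 0) (by fun_prop)]
  have hI := integrable_quantile μ (h := fun y => max (y - k) 0) (by fun_prop)
    (integrable_call hi k)
  have hI' := hI.restrict (s := Ioo α 1)
  rw [restrict_unif_Ioo hα] at hI'
  have h1 : ∫ t in Ioo α 1, quantile μ t ≤ ∫ t in Ioo α 1, (k + max (quantile μ t - k) 0) := by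
    refine integral_mono (integrableOn_quantile hi hα) ?_ fun t => ?_
    · exact Integrable.add (by simp) hI'
    · simp only
      linarith [le_max_left (quantile μ t - k) 0]
  have h2 : ∫ t in Ioo α 1, max (quantile μ t - k) 0 ≤ ∫ t, max (quantile μ t - k) 0 ∂unif := by
    rw [← restrict_unif_Ioo hα]
    exact setIntegral_le_integral hI (ae_of_all _ fun t => le_max_right _ _)
  rw [integral_add (by simp) hI'] at h1
  simp only [integral_const, MeasurableSet.univ, measureReal_restrict_apply, univ_inter,
    Real.volume_real_Ioo_of_le hα.2.le, smul_eq_mul] at h1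
  linarith

/-- The Rockafellar–Uryasev formula at the optimum. -/
lemma superquantile_eq_call (hi : Integrable (fun y => y) μ) {α : ℝ} (hα : α ∈ Ioo (0 : ℝ) 1) :
    ∫ t in α..1, genInv (cdf μ) t =
      (1 - α) * quantile μ α + ∫ y, max (y - quantile μ α) 0 ∂μ := by
  set k := quantile μ α
  rw [superquantile_eq μ hα, ← integral_quantile μ (h := fun y => max (y - k) 0) (by fun_prop)]
  have hI := integrable_quantile μ (h := fun y => max (y - k) 0) (by fun_prop)
    (integrable_call hi k)
  have hI' := hI.restrict (s := Ioo α 1)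
  rw [restrict_unif_Ioo hα] at hI'
  have h1 : ∫ t in Ioo α 1, quantile μ t = ∫ t in Ioo α 1, (k + max (quantile μ t - k) 0) := by
    refine setIntegral_congr_fun measurableSet_Ioo fun t ht => ?_
    have : k ≤ quantile μ t := monotoneOn_quantile μ hα ⟨hα.1.trans ht.1, ht.2⟩ ht.1.le
    rw [max_eq_left (by linarith)]
    ring
  have h2 : ∫ t, max (quantile μ t - k) 0 ∂unif = ∫ t in Ioo α 1, max (quantile μ t - k) 0 := by
    refine setIntegral_eq_of_subset_of_forall_sdiff_eq_zero measurableSet_Ioo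
      (Ioo_subset_Ioo_left hα.1.le) fun t ht => ?_
    have hle : t ≤ α := by
      by_contra h
      exact ht.2 ⟨not_le.1 h, ht.1.2⟩
    have : quantile μ t ≤ k := monotoneOn_quantile μ ht.1 hα hle
    exact max_eq_right (by linarith)
  rw [integral_add (by simp) hI'] at h1
  simp only [integral_const, MeasurableSet.univ, measureReal_restrict_apply, univ_inter,
    Real.volume_real_Ioo_of_le hα.2.le, smul_eq_mul] at h1
  linarith

/-- The superquantile is the minimum over `k` of `(1 - α) k + E(Y - k)⁺`. It suffices to test `μ` at
the minimizer of `ν`. -/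
lemma superquantile_mono {ν : Measure ℝ} [IsProbabilityMeasure ν]
    (hμ : Integrable (fun y => y) μ) (hν : Integrable (fun y => y) ν)
    (h : ∀ k : ℝ, ∫ y, max (y - k) 0 ∂μ ≤ ∫ y, max (y - k) 0 ∂ν) {α : ℝ}
    (hα : α ∈ Ioo (0 : ℝ) 1) :
    ∫ t in α..1, genInv (cdf μ) t ≤ ∫ t in α..1, genInv (cdf ν) t := by
  rw [superquantile_eq_call hν hα]
  exact (superquantile_le hμ hα (quantile ν α)).trans
    (add_le_add_right (h _) _)

lemma neg_le_integral_call (hi : Integrable (fun y => y) μ) (h0 : ∫ y, y ∂μ = 0) (k : ℝ) :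
    -k ≤ ∫ y, max (y - k) 0 ∂μ := by
  have : ∫ y, (y - k) ∂μ = -k := by
    rw [integral_sub hi (integrable_const k), h0]; simp
  rw [← this]
  exact integral_mono (hi.sub (integrable_const k)) (integrable_call hi k)
    fun y => le_max_left _ _

/-- Superquantiles of a centered law are nonnegative. -/
lemma superquantile_ge (hi : Integrable (fun y => y) μ) {α : ℝ} (hα : α ∈ Ioo (0 : ℝ) 1)
    (h0 : ∫ y, y ∂μ = 0) : 0 ≤ ∫ t in α..1, genInv (cdf μ) t := by
  rw [superquantile_eq_call hi hα]
  set k := quantile μ α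
  have h1 : 0 ≤ ∫ y, max (y - k) 0 ∂μ := integral_nonneg fun y => le_max_right _ _
  have h2 : -k ≤ ∫ y, max (y - k) 0 ∂μ := neg_le_integral_call hi h0 k
  rcases le_total 0 k with hk | hk
  · have := mul_nonneg (sub_nonneg.2 hα.2.le) hk
    linarith
  · nlinarith [hα.1, hα.2]

/-- Superquantiles of a non-degenerate centered law are positive. -/
lemma superquantile_pos (hi : Integrable (fun y => y) μ) {α : ℝ} (hα : α ∈ Ioo (0 : ℝ) 1)
    (h0 : ∫ y, y ∂μ = 0) (hnd : ¬ ∀ᵐ y ∂μ, y = 0) : 0 < ∫ t in α..1, genInv (cdf μ) t := by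
  rw [superquantile_eq_call hi hα]
  set k := quantile μ α
  have h1 : 0 ≤ ∫ y, max (y - k) 0 ∂μ := integral_nonneg fun y => le_max_right _ _
  have h2 : -k ≤ ∫ y, max (y - k) 0 ∂μ := neg_le_integral_call hi h0 k
  -- For `k > 0` the first term is positive; for `k < 0` the bound `-k` on the call leaves `-α k >
  -- 0`; for `k = 0` a vanishing call gives `y ≤ 0` almost surely, hence `y = 0` by centering.
  rcases lt_trichotomy 0 k with hk | hk | hk
  · have := mul_pos (sub_pos.2 hα.2) hk
    linarith
  · rw [← hk]
    refine lt_of_le_of_ne (by simpa [← hk] using h1) fun h => hnd ?_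
    have hz : ∫ y, max (y - 0) 0 ∂μ = 0 := by simpa using h.symm
    have hz1 := (integral_eq_zero_iff_of_nonneg (fun y => le_max_right _ _)
      (integrable_call hi 0)).1 hz
    have hle : ∀ᵐ y ∂μ, y ≤ 0 := by
      filter_upwards [hz1] with y hy
      simpa using hy
    have hz2 : ∫ y, -y ∂μ = 0 := by rw [integral_neg, h0, neg_zero]
    have hz3 := (integral_eq_zero_iff_of_nonneg_ae (by
      filter_upwards [hle] with y hy
      simpa using hy) hi.neg).1 hz2
    filter_upwards [hz3] with y hy
    simpa using hy
  · nlinarith [hα.1, hα.2]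

end Quantile

/-! ### Weighted images of the uniform law -/

section Push

/-- The image by `f` of the measure with density `r` on `(0, 1)`. -/
noncomputable def push (r : ℝ → ℝ) (f : ℝ → ℝ × ℝ) : Measure (ℝ × ℝ) :=
  (unif.withDensity fun t => ENNReal.ofReal (r t)).map f

lemma lintegral_push {r : ℝ → ℝ} {f : ℝ → ℝ × ℝ} (hr : Measurable r) (hf : Measurable f)
    {h : ℝ × ℝ → ENNReal} (hh : Measurable h) :
    ∫⁻ w, h w ∂(push r f) = ∫⁻ t, ENNReal.ofReal (r t) * h (f t) ∂unif := by
  rw [push, lintegral_map hh hf]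
  exact lintegral_withDensity_eq_lintegral_mul _ hr.ennreal_ofReal (hh.comp hf)

lemma integral_push {r : ℝ → ℝ} {f : ℝ → ℝ × ℝ} (hr : Measurable r) (hf : Measurable f)
    {h : ℝ × ℝ → ℝ} (hh : Measurable h) :
    ∫ w, h w ∂(push r f) = ∫ t, max (r t) 0 * h (f t) ∂unif := by
  rw [push, integral_map hf.aemeasurable hh.aestronglyMeasurable,
    integral_withDensity_eq_integral_toReal_smul hr.ennreal_ofReal (by simp)]
  simp [ENNReal.toReal_ofReal']

lemma integrable_push {r : ℝ → ℝ} {f : ℝ → ℝ × ℝ} (hr : Measurable r) (hf : Measurable f)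
    {h : ℝ × ℝ → ℝ} (hh : Measurable h) (hi : Integrable h (push r f)) :
    Integrable (fun t => max (r t) 0 * h (f t)) unif := by
  rw [push, integrable_map_measure hh.aestronglyMeasurable hf.aemeasurable,
    integrable_withDensity_iff_integrable_smul₀' hr.ennreal_ofReal.aemeasurable (by simp)] at hi
  simpa [ENNReal.toReal_ofReal'] using hi

/-- The kernel version of `push`. -/
lemma exists_kernel_push {α : Type*} [MeasurableSpace α] {r : α × ℝ → ℝ} {f : α × ℝ → ℝ × ℝ}
    (hr : Measurable r) (hf : Measurable f) :
    ∃ κ : Kernel α (ℝ × ℝ), ∀ a, κ a = push (fun t => r (a, t)) (fun t => f (a, t)) := by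
  refine ⟨⟨fun a => push (fun t => r (a, t)) (fun t => f (a, t)), ?_⟩, fun a => rfl⟩
  refine Measure.measurable_of_measurable_coe _ fun s hs => ?_
  have : ∀ a, push (fun t => r (a, t)) (fun t => f (a, t)) s =
      ∫⁻ t, ENNReal.ofReal (r (a, t)) * s.indicator 1 (f (a, t)) ∂unif := fun a => by
    rw [← lintegral_indicator_one hs]
    exact lintegral_push (hr.comp measurable_prodMk_left)
      (hf.comp measurable_prodMk_left) (measurable_one.indicator hs)
  simp_rw [this]
  exact Measurable.lintegral_prod_right'
    (f := fun p : α × ℝ => ENNReal.ofReal (r p) * s.indicator 1 (f p))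
    (hr.ennreal_ofReal.mul ((measurable_one.indicator hs).comp hf))

end Push

/-! ### Normalized densities and change of variables -/

section Normalize

variable {α : Type*} [MeasurableSpace α]

/-- A normalized density on `(0, 1)`, depending measurably on a parameter, and the corresponding
change of variables by its quantile function. -/
lemma exists_normalized {g : α × ℝ → ℝ} (hg : Measurable g) (hg0 : ∀ p, 0 ≤ g p)
    (hgi : ∀ a, Integrable (fun t => g (a, t)) unif) :
    ∃ ρ : Kernel α ℝ, IsMarkovKernel ρ ∧ ∀ a, ∫ t, g (a, t) ∂unif ≠ 0 →
      ∀ h : ℝ → ENNReal, Measurable h → ENNReal.ofReal (∫ t, g (a, t) ∂unif) * ∫⁻ t, h t ∂(ρ a) =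
        ∫⁻ t, ENNReal.ofReal (g (a, t)) * h t ∂unif := by
  set M : α → ℝ := fun a => ∫ t, g (a, t) ∂unif with hM
  have hM0 : ∀ a, 0 ≤ M a := fun a => integral_nonneg fun t => hg0 _
  have hMm : Measurable M := by
    have : StronglyMeasurable M := StronglyMeasurable.integral_prod_right' hg.stronglyMeasurable
    exact this.measurable
  have hMl : ∀ a, ENNReal.ofReal (M a) = ∫⁻ t, ENNReal.ofReal (g (a, t)) ∂unif := fun a =>
    ofReal_integral_eq_lintegral_ofReal (hgi a) (ae_of_all _ fun t => hg0 _)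
  -- The default weight `1` for zero mass keeps the kernel Markov at every parameter.
  set w : α → ℝ → ENNReal := fun a t =>
    if M a = 0 then 1 else (ENNReal.ofReal (M a))⁻¹ * ENNReal.ofReal (g (a, t)) with hw
  have hwm : Measurable (Function.uncurry w) := by
    refine Measurable.ite ?_ measurable_const ?_
    · exact (hMm.comp measurable_fst) (measurableSet_singleton 0)
    · exact ((hMm.comp measurable_fst).ennreal_ofReal.inv).mul hg.ennreal_ofReal
  have key : ∀ a, M a ≠ 0 → ∀ h : ℝ → ENNReal, Measurable h → ENNReal.ofReal (M a) *
      ∫⁻ t, h t ∂((Kernel.const α unif).withDensity w a) =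
        ∫⁻ t, ENNReal.ofReal (g (a, t)) * h t ∂unif := fun a ha h hh => by
    have hpos : 0 < M a := lt_of_le_of_ne (hM0 a) (Ne.symm ha)
    have hm : Measurable fun t => w a t * h t := (hwm.comp measurable_prodMk_left).mul hh
    rw [Kernel.lintegral_withDensity _ hwm _ hh, ← lintegral_const_mul _ hm]
    refine lintegral_congr fun t => ?_
    simp only [hw, ha, if_false]
    rw [← mul_assoc, ← mul_assoc, ENNReal.mul_inv_cancel (by simpa using hpos) (by simp), one_mul]
  refine ⟨(Kernel.const α unif).withDensity w, ⟨fun a => ⟨?_⟩⟩, key⟩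
  by_cases ha : M a = 0
  · rw [Kernel.withDensity_apply _ hwm]
    have : w a = 1 := by ext t; simp [hw, ha]
    rw [this]
    simp
  · have h1 := key a ha 1 measurable_one
    simp only [Pi.one_apply, lintegral_one, mul_one] at h1
    rw [← hMl] at h1
    have hpos : 0 < M a := lt_of_le_of_ne (hM0 a) (Ne.symm ha)
    exact (ENNReal.mul_eq_left (by simpa using hpos) (by simp)).1 h1

variable {M : ℝ} {g : ℝ → ℝ} {ρ : Measure ℝ} [IsProbabilityMeasure ρ]

/-- The law `ρ` has density `g / M`, so its quantile function lands almost surely where `g > 0`.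
This keeps the denominators of the four-point weights away from zero. -/
lemma ae_pos_of_normalized (hg : Measurable g) (hM : 0 < M)
    (hρ : ∀ h : ℝ → ENNReal, Measurable h → ENNReal.ofReal M * ∫⁻ t, h t ∂ρ =
      ∫⁻ t, ENNReal.ofReal (g t) * h t ∂unif) :
    ∀ᵐ t ∂unif, quantile ρ t ∈ Ioo (0 : ℝ) 1 ∧ 0 < g (quantile ρ t) := by
  have hS : MeasurableSet {s : ℝ | s ∈ Ioo (0 : ℝ) 1 ∧ 0 < g s} :=
    measurableSet_Ioo.inter (measurableSet_lt measurable_const hg)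
  have h1 := hρ ({s : ℝ | s ∈ Ioo (0 : ℝ) 1 ∧ 0 < g s}ᶜ.indicator 1)
    (measurable_one.indicator hS.compl)
  rw [lintegral_indicator_one hS.compl] at h1
  have h2 : ∫⁻ t, ENNReal.ofReal (g t) *
      {s : ℝ | s ∈ Ioo (0 : ℝ) 1 ∧ 0 < g s}ᶜ.indicator 1 t ∂unif = 0 := by
    refine (lintegral_eq_zero_iff
      (hg.ennreal_ofReal.mul (measurable_one.indicator hS.compl))).2 ?_
    filter_upwards [ae_restrict_mem measurableSet_Ioo] with t ht
    by_cases hgt : 0 < g t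
    · simp [ht.1, ht.2, hgt]
    · simp [ENNReal.ofReal_of_nonpos (not_lt.1 hgt)]
  rw [h2, mul_eq_zero, or_iff_right (by simpa using hM)] at h1
  have h3 : ∀ᵐ s ∂ρ, s ∈ Ioo (0 : ℝ) 1 ∧ 0 < g s := h1
  rw [← map_quantile ρ] at h3
  exact ae_of_ae_map (measurable_quantile ρ).aemeasurable h3

/-- The weight `M / g` undoes the density `g / M`: transporting by the quantile function of `ρ`
gives back Lebesgue measure on `{g > 0}`. -/
lemma lintegral_normalized (hg : Measurable g) (hg0 : ∀ t, 0 ≤ g t) (hM : 0 < M)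
    (hρ : ∀ h : ℝ → ENNReal, Measurable h → ENNReal.ofReal M * ∫⁻ t, h t ∂ρ =
      ∫⁻ t, ENNReal.ofReal (g t) * h t ∂unif) {H : ℝ → ENNReal} (hH : Measurable H) :
    ∫⁻ t, ENNReal.ofReal (M / g (quantile ρ t)) * H (quantile ρ t) ∂unif =
      ∫⁻ t, {s | 0 < g s}.indicator H t ∂unif := by
  have h1 := hρ (fun t => ENNReal.ofReal (1 / g t) * H t) (by fun_prop)
  have hm : Measurable fun t =>
      ENNReal.ofReal (1 / g (quantile ρ t)) * H (quantile ρ t) :=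
    (by fun_prop : Measurable fun t => ENNReal.ofReal (1 / g t) * H t).comp (measurable_quantile ρ)
  rw [← lintegral_quantile ρ (by fun_prop), ← lintegral_const_mul _ hm] at h1
  calc _ = ∫⁻ t, ENNReal.ofReal M *
        (ENNReal.ofReal (1 / g (quantile ρ t)) * H (quantile ρ t)) ∂unif := by
        refine lintegral_congr fun t => ?_
        rw [← mul_assoc, ← ENNReal.ofReal_mul hM.le, mul_one_div]
    _ = _ := h1
    _ = _ := by
        refine lintegral_congr fun t => ?_
        rw [← mul_assoc, ← ENNReal.ofReal_mul (hg0 t)]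
        rcases (hg0 t).eq_or_lt with h | h
        · rw [indicator_of_notMem (by simp [← h]), ← h]
          simp
        · rw [indicator_of_mem (by exact h), mul_one_div_cancel h.ne']
          simp

end Normalize

/-! ### The four-point martingale coupling -/

section FourPoint

/-- Given `A < a ≤ b < B`, the four weights below define a measure on `{a, b} × {A, B}` whose
conditional means given the first coordinate equal the first coordinate. The coupling leaves mass
in place where `F = G`, and combines such four-point measures elsewhere. -/
noncomputable def fourPoint (F G Tp Tm : ℝ → ℝ) (M : ℝ) : Measure (ℝ × ℝ) :=
  push (fun t => if F t = G t then 1 else 0) (fun t => (F t, G t)) +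
  (push (fun t => M * (G (Tm t) - F (Tp t)) / ((G (Tm t) - G (Tp t)) * (F (Tp t) - G (Tp t))))
    (fun t => (F (Tp t), G (Tp t))) +
  (push (fun t => M / (G (Tm t) - G (Tp t))) (fun t => (F (Tp t), G (Tm t))) +
  (push (fun t => M / (G (Tm t) - G (Tp t))) (fun t => (F (Tm t), G (Tp t))) +
  push (fun t => M * (F (Tm t) - G (Tp t)) / ((G (Tm t) - G (Tp t)) * (G (Tm t) - F (Tm t))))
    (fun t => (F (Tm t), G (Tm t))))))

variable {F G Tp Tm : ℝ → ℝ} {M : ℝ}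

lemma lintegral_fourPoint (hF : Measurable F) (hG : Measurable G) (hTp : Measurable Tp)
    (hTm : Measurable Tm) {h : ℝ × ℝ → ENNReal} (hh : Measurable h) :
    ∫⁻ w, h w ∂(fourPoint F G Tp Tm M) =
      ∫⁻ t, ({s | F s = G s}.indicator (fun s => h (F s, G s)) t +
        (ENNReal.ofReal (M * (G (Tm t) - F (Tp t)) /
            ((G (Tm t) - G (Tp t)) * (F (Tp t) - G (Tp t)))) * h (F (Tp t), G (Tp t)) +
        (ENNReal.ofReal (M / (G (Tm t) - G (Tp t))) * h (F (Tp t), G (Tm t)) +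
        (ENNReal.ofReal (M / (G (Tm t) - G (Tp t))) * h (F (Tm t), G (Tp t)) +
        ENNReal.ofReal (M * (F (Tm t) - G (Tp t)) /
            ((G (Tm t) - G (Tp t)) * (G (Tm t) - F (Tm t)))) * h (F (Tm t), G (Tm t)))))) ∂unif := by
  have hE : MeasurableSet {s | F s = G s} := measurableSet_eq_fun hF hG
  have hm0 : Measurable fun t => if F t = G t then (1 : ℝ) else 0 :=
    Measurable.ite hE measurable_const measurable_const
  rw [fourPoint, lintegral_add_measure, lintegral_add_measure, lintegral_add_measure,
    lintegral_add_measure, lintegral_push hm0 (by fun_prop) hh,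
    lintegral_push (by fun_prop) (by fun_prop) hh, lintegral_push (by fun_prop) (by fun_prop) hh,
    lintegral_push (by fun_prop) (by fun_prop) hh, lintegral_push (by fun_prop) (by fun_prop) hh,
    lintegral_add_left (Measurable.indicator (by fun_prop) hE), lintegral_add_left (by fun_prop),
    lintegral_add_left (by fun_prop), lintegral_add_left (by fun_prop)]
  congr 1
  refine lintegral_congr fun t => ?_
  by_cases ht : F t = G t
  · rw [indicator_of_mem (by exact ht)]; simp [ht]
  · rw [indicator_of_notMem (by exact ht)]; simp [ht]

variable (hF : Measurable F) (hG : Measurable G) (hTp : Measurable Tp) (hTm : Measurable Tm)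
  (hM : 0 ≤ M)
  (hord : ∀ᵐ t ∂unif, M = 0 ∨ (G (Tp t) < F (Tp t) ∧ F (Tp t) ≤ F (Tm t) ∧ F (Tm t) < G (Tm t)))
  (hp : ∀ H : ℝ → ENNReal, Measurable H →
    ∫⁻ t, ENNReal.ofReal (M / (F (Tp t) - G (Tp t))) * H (Tp t) ∂unif =
      ∫⁻ t, {s | G s < F s}.indicator H t ∂unif)
  (hm : ∀ H : ℝ → ENNReal, Measurable H →
    ∫⁻ t, ENNReal.ofReal (M / (G (Tm t) - F (Tm t))) * H (Tm t) ∂unif =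
      ∫⁻ t, {s | F s < G s}.indicator H t ∂unif)

-- The diagonal part and the two transported parts cover `{F = G}`, `{G < F}` and `{F < G}`, hence
-- all of `(0, 1)`.
include hF hG hTp hp hm in
lemma lintegral_fourPoint_aux {H : ℝ → ENNReal} (hH : Measurable H) :
    ∫⁻ t, ({s | F s = G s}.indicator H t +
      (ENNReal.ofReal (M / (F (Tp t) - G (Tp t))) * H (Tp t) +
      ENNReal.ofReal (M / (G (Tm t) - F (Tm t))) * H (Tm t))) ∂unif = ∫⁻ t, H t ∂unif := by
  have hE : MeasurableSet {s | F s = G s} := measurableSet_eq_fun hF hG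
  have hE1 : MeasurableSet {s | G s < F s} := measurableSet_lt hG hF
  rw [lintegral_add_left (hH.indicator hE), lintegral_add_left (by fun_prop), hp H hH, hm H hH,
    ← lintegral_add_left (hH.indicator hE1), ← lintegral_add_left (hH.indicator hE)]
  refine lintegral_congr fun t => ?_
  rcases lt_trichotomy (F t) (G t) with h | h | h
  · simp [indicator, h, h.ne, h.not_gt]
  · simp [indicator, h]
  · simp [indicator, h, h.ne', h.not_gt]

include hF hG hTp hTm hM hord hp hm

lemma lintegral_fst_fourPoint {h : ℝ → ENNReal} (hh : Measurable h) :
    ∫⁻ w, h w.1 ∂(fourPoint F G Tp Tm M) = ∫⁻ t, h (F t) ∂unif := by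
  rw [lintegral_fourPoint hF hG hTp hTm (h := fun w => h w.1) (by fun_prop),
    ← lintegral_fourPoint_aux hF hG hTp hp hm (H := fun t => h (F t)) (by fun_prop)]
  refine lintegral_congr_ae ?_
  filter_upwards [hord] with t ht
  congr 1
  rcases ht with rfl | ⟨h1, h2, h3⟩
  · simp
  have e1 : 0 < F (Tp t) - G (Tp t) := by linarith
  have e2 : 0 < G (Tm t) - F (Tm t) := by linarith
  have e3 : 0 < G (Tm t) - G (Tp t) := by linarith
  have e4 : 0 ≤ G (Tm t) - F (Tp t) := by linarith
  have e5 : 0 ≤ F (Tm t) - G (Tp t) := by linarith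
  -- With `a = F (Tp t)`, `A = G (Tp t)`, `b = F (Tm t)`, `B = G (Tm t)`, the weights at `a` add up
  -- to `M / (a - A)` and those at `b` to `M / (B - b)`.
  rw [← add_assoc, ← add_mul, ← add_mul, ← ENNReal.ofReal_add (by positivity) (by positivity),
    ← ENNReal.ofReal_add (by positivity) (by positivity)]
  congr 3 <;> field_simp <;> ring

lemma lintegral_snd_fourPoint {h : ℝ → ENNReal} (hh : Measurable h) :
    ∫⁻ w, h w.2 ∂(fourPoint F G Tp Tm M) = ∫⁻ t, h (G t) ∂unif := by
  rw [lintegral_fourPoint hF hG hTp hTm (h := fun w => h w.2) (by fun_prop),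
    ← lintegral_fourPoint_aux hF hG hTp hp hm (H := fun t => h (G t)) (by fun_prop)]
  refine lintegral_congr_ae ?_
  filter_upwards [hord] with t ht
  congr 1
  rcases ht with rfl | ⟨h1, h2, h3⟩
  · simp
  have e1 : 0 < F (Tp t) - G (Tp t) := by linarith
  have e2 : 0 < G (Tm t) - F (Tm t) := by linarith
  have e3 : 0 < G (Tm t) - G (Tp t) := by linarith
  have e4 : 0 ≤ G (Tm t) - F (Tp t) := by linarith
  have e5 : 0 ≤ F (Tm t) - G (Tp t) := by linarith
  -- The terms are regrouped by second coordinate; the total weights at `A` and `B` are again `M /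
  -- (a - A)` and `M / (B - b)`.
  rw [add_left_comm (ENNReal.ofReal (M / (G (Tm t) - G (Tp t))) * h (G (Tm t))), ← add_assoc,
    ← add_mul, ← add_mul, ← ENNReal.ofReal_add (by positivity) (by positivity),
    ← ENNReal.ofReal_add (by positivity) (by positivity)]
  congr 3 <;> field_simp <;> ring

lemma map_fst_fourPoint : (fourPoint F G Tp Tm M).map Prod.fst = unif.map F := by
  refine Measure.ext_of_lintegral _ fun h hh => ?_
  rw [lintegral_map hh measurable_fst, lintegral_map hh hF]
  exact lintegral_fst_fourPoint hF hG hTp hTm hM hord hp hm hh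

lemma map_snd_fourPoint : (fourPoint F G Tp Tm M).map Prod.snd = unif.map G := by
  refine Measure.ext_of_lintegral _ fun h hh => ?_
  rw [lintegral_map hh measurable_snd, lintegral_map hh hG]
  exact lintegral_snd_fourPoint hF hG hTp hTm hM hord hp hm hh

/-- The martingale property of `fourPoint`. -/
lemma integral_fourPoint (hFi : Integrable F unif) (hGi : Integrable G unif) {s : Set ℝ}
    (hs : MeasurableSet s) :
    ∫ w in Prod.fst ⁻¹' s, (w.2 - w.1) ∂(fourPoint F G Tp Tm M) = 0 := by
  have hF' : Integrable (fun w : ℝ × ℝ => w.1) (fourPoint F G Tp Tm M) := by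
    refine (integrable_map_measure (g := fun x : ℝ => x) aestronglyMeasurable_id
      measurable_fst.aemeasurable).1 ?_
    rw [map_fst_fourPoint hF hG hTp hTm hM hord hp hm]
    exact (integrable_map_measure aestronglyMeasurable_id hF.aemeasurable).2 hFi
  have hG' : Integrable (fun w : ℝ × ℝ => w.2) (fourPoint F G Tp Tm M) := by
    refine (integrable_map_measure (g := fun x : ℝ => x) aestronglyMeasurable_id
      measurable_snd.aemeasurable).1 ?_
    rw [map_snd_fourPoint hF hG hTp hTm hM hord hp hm]
    exact (integrable_map_measure aestronglyMeasurable_id hG.aemeasurable).2 hGi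
  have hs' : MeasurableSet (Prod.fst ⁻¹' s : Set (ℝ × ℝ)) := measurable_fst hs
  rw [← integral_indicator hs']
  set k : ℝ × ℝ → ℝ := (Prod.fst ⁻¹' s).indicator fun w => w.2 - w.1 with hk
  have hkm : Measurable k := Measurable.indicator (by fun_prop) hs'
  have hki : Integrable k (fourPoint F G Tp Tm M) := (hG'.sub hF').indicator hs'
  have hkv : ∀ a b, k (a, b) = s.indicator 1 a * (b - a) := fun a b => by
    by_cases h : a ∈ s <;> simp [hk, indicator, h]
  have hE : MeasurableSet {s | F s = G s} := measurableSet_eq_fun hF hG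
  have hm0 : Measurable fun t => if F t = G t then (1 : ℝ) else 0 :=
    Measurable.ite hE measurable_const measurable_const
  rw [fourPoint, integrable_add_measure, integrable_add_measure, integrable_add_measure,
    integrable_add_measure] at hki
  obtain ⟨i0, i1, i2, i3, i4⟩ := hki
  have j1 := integrable_push (by fun_prop) (by fun_prop) hkm i1
  have j2 := integrable_push (by fun_prop) (by fun_prop) hkm i2
  have j3 := integrable_push (by fun_prop) (by fun_prop) hkm i3
  have j4 := integrable_push (by fun_prop) (by fun_prop) hkm i4
  rw [fourPoint, integral_add_measure i0 (i1.add_measure (i2.add_measure (i3.add_measure i4))),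
    integral_add_measure i1 (i2.add_measure (i3.add_measure i4)),
    integral_add_measure i2 (i3.add_measure i4), integral_add_measure i3 i4,
    integral_push hm0 (by fun_prop) hkm,
    integral_push (by fun_prop) (by fun_prop) hkm, integral_push (by fun_prop) (by fun_prop) hkm,
    integral_push (by fun_prop) (by fun_prop) hkm, integral_push (by fun_prop) (by fun_prop) hkm,
    ← integral_add' j3 j4, ← integral_add' j2 (j3.add j4),
    ← integral_add' j1 (j2.add (j3.add j4))]
  -- The diagonal part contributes nothing. In the other four terms the cancellation is pointwise in
  -- `t`, between the two atoms that share a first coordinate.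
  have z0 : ∀ t, max (if F t = G t then (1 : ℝ) else 0) 0 * k (F t, G t) = 0 := fun t => by
    by_cases h : F t = G t <;> simp [h, hkv]
  simp only [z0, integral_zero, zero_add]
  refine integral_eq_zero_of_ae ?_
  filter_upwards [hord] with t ht
  simp only [hkv, Pi.add_apply, Pi.zero_apply]
  rcases ht with rfl | ⟨h1, h2, h3⟩
  · simp
  have e1 : 0 < F (Tp t) - G (Tp t) := by linarith
  have e2 : 0 < G (Tm t) - F (Tm t) := by linarith
  have e3 : 0 < G (Tm t) - G (Tp t) := by linarith
  have e4 : 0 ≤ G (Tm t) - F (Tp t) := by linarith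
  have e5 : 0 ≤ F (Tm t) - G (Tp t) := by linarith
  rw [max_eq_left (by positivity), max_eq_left (by positivity), max_eq_left (by positivity)]
  field_simp
  ring

end FourPoint

/-! ### Measurable Strassen theorem and gluing -/

/-- With equal means, the lower-tail integral of the difference is minus the upper-tail one, which
the superquantiles control. -/
lemma setIntegral_quantile_sub_nonneg {μ ν : Measure ℝ} [IsProbabilityMeasure μ]
    [IsProbabilityMeasure ν] (hμ : Integrable (fun y => y) μ) (hν : Integrable (fun y => y) ν)
    (hmean : ∫ y, y ∂μ = ∫ y, y ∂ν)
    (hsq : ∀ u ∈ Ioo (0 : ℝ) 1,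
      ∫ t in u..1, genInv (cdf μ) t ≤ ∫ t in u..1, genInv (cdf ν) t) (x : ℝ) :
    0 ≤ ∫ t in Iic x, (quantile μ t - quantile ν t) ∂unif := by
  have iμ := integrable_quantile μ measurable_id hμ
  have iν := integrable_quantile ν measurable_id hν
  have htot : ∫ t, (quantile μ t - quantile ν t) ∂unif = 0 := by
    have h1 := integral_quantile μ measurable_id
    have h2 := integral_quantile ν measurable_id
    simp only [id] at h1 h2 iμ iν
    rw [integral_sub iμ iν, h1, h2, hmean, sub_self]
  have hsplit := integral_add_compl (μ := unif) (measurableSet_Iic (a := x)) (iμ.sub iν)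
  simp only [Pi.sub_apply, id] at hsplit
  rw [htot, compl_Iic] at hsplit
  rcases le_or_gt x 0 with hx | hx
  · rw [Measure.restrict_restrict measurableSet_Iic]
    have : Iic x ∩ Ioo (0 : ℝ) 1 = ∅ := by
      ext t; simp only [mem_inter_iff, mem_Iic, mem_Ioo, mem_empty_iff_false, iff_false]
      intro h; linarith [h.1, h.2.1]
    simp [this]
  rcases le_or_gt 1 x with hx1 | hx1
  · rw [Measure.restrict_restrict measurableSet_Ioi] at hsplit
    have : Ioi x ∩ Ioo (0 : ℝ) 1 = ∅ := by
      ext t; simp only [mem_inter_iff, mem_Ioi, mem_Ioo, mem_empty_iff_false, iff_false]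
      intro h; linarith [h.1, h.2.2]
    simp only [this, Measure.restrict_empty, integral_zero_measure] at hsplit
    linarith
  · have hx' : x ∈ Ioo (0 : ℝ) 1 := ⟨hx, hx1⟩
    rw [Measure.restrict_restrict measurableSet_Ioi] at hsplit
    have : Ioi x ∩ Ioo (0 : ℝ) 1 = Ioo x 1 := by
      ext t; simp only [mem_inter_iff, mem_Ioi, mem_Ioo]
      exact ⟨fun h => ⟨h.1, h.2.2⟩, fun h => ⟨h.1, hx.trans h.1, h.2⟩⟩
    rw [this, integral_sub (integrableOn_quantile hμ hx') (integrableOn_quantile hν hx'),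
      ← superquantile_eq _ hx', ← superquantile_eq _ hx'] at hsplit
    linarith [hsq x hx']

/-- A measurable version of Strassen's theorem on the real line: kernels which are ordered by
their superquantiles admit a kernel of martingale couplings. -/
theorem exists_martingale_kernel {α : Type*} [MeasurableSpace α] (μ ν : Kernel α ℝ)
    [IsMarkovKernel μ] [IsMarkovKernel ν] (hμ : ∀ a, Integrable (fun y => y) (μ a))
    (hν : ∀ a, Integrable (fun y => y) (ν a)) (hmean : ∀ a, ∫ y, y ∂(μ a) = ∫ y, y ∂(ν a))
    (hsq : ∀ a, ∀ u ∈ Ioo (0 : ℝ) 1,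
      ∫ t in u..1, genInv (cdf (μ a)) t ≤ ∫ t in u..1, genInv (cdf (ν a)) t) :
    ∃ π : Kernel α (ℝ × ℝ), (∀ a, (π a).map Prod.fst = μ a) ∧ (∀ a, (π a).map Prod.snd = ν a) ∧
      ∀ a s, MeasurableSet s → ∫ w in Prod.fst ⁻¹' s, (w.2 - w.1) ∂(π a) = 0 := by
  set F : α × ℝ → ℝ := fun p => quantile (μ p.1) p.2 with hFdef
  set G : α × ℝ → ℝ := fun p => quantile (ν p.1) p.2 with hGdef
  have hF : Measurable F := measurable_quantile_kernel μ
  have hG : Measurable G := measurable_quantile_kernel ν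
  have iF : ∀ a, Integrable (fun t => F (a, t)) unif := fun a =>
    integrable_quantile (μ a) measurable_id (hμ a)
  have iG : ∀ a, Integrable (fun t => G (a, t)) unif := fun a =>
    integrable_quantile (ν a) measurable_id (hν a)
  have ip : ∀ a, Integrable (fun t => max (F (a, t) - G (a, t)) 0) unif := fun a =>
    ((iF a).sub (iG a)).pos_part
  have im : ∀ a, Integrable (fun t => max (G (a, t) - F (a, t)) 0) unif := fun a =>
    ((iG a).sub (iF a)).pos_part
  set M : α → ℝ := fun a => ∫ t, max (F (a, t) - G (a, t)) 0 ∂unif with hMdef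
  have hdiff : ∀ a t, max (F (a, t) - G (a, t)) 0 - max (G (a, t) - F (a, t)) 0 =
      F (a, t) - G (a, t) := fun a t => by
    rcases le_total (F (a, t)) (G (a, t)) with h | h
    · rw [max_eq_right (by linarith), max_eq_left (by linarith)]; ring
    · rw [max_eq_left (by linarith), max_eq_right (by linarith)]; ring
  -- Equal means make the positive and negative parts of `F - G` equal in mass, so one constant `M`
  -- normalizes both.
  have hM' : ∀ a, ∫ t, max (G (a, t) - F (a, t)) 0 ∂unif = M a := fun a => by
    have h1 := integral_quantile (μ a) measurable_id
    have h2 := integral_quantile (ν a) measurable_id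
    simp only [id] at h1 h2
    have h3 : ∫ t, (max (F (a, t) - G (a, t)) 0 - max (G (a, t) - F (a, t)) 0) ∂unif = 0 := by
      simp only [hdiff]
      rw [integral_sub (iF a) (iG a)]
      simp only [hFdef, hGdef, h1, h2, hmean, sub_self]
    rw [integral_sub (ip a) (im a)] at h3
    simp only [hMdef]
    linarith
  have hM0 : ∀ a, 0 ≤ M a := fun a => integral_nonneg fun t => le_max_right _ _
  have hMm : Measurable M := by
    have : StronglyMeasurable M := StronglyMeasurable.integral_prod_right'
      (f := fun p => max (F p - G p) 0) (by fun_prop : Measurable _).stronglyMeasurable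
    exact this.measurable
  obtain ⟨ρp, hρpM, hρp⟩ := exists_normalized (g := fun p => max (F p - G p) 0)
    (by fun_prop) (fun p => le_max_right _ _) ip
  obtain ⟨ρm, hρmM, hρm⟩ := exists_normalized (g := fun p => max (G p - F p) 0)
    (by fun_prop) (fun p => le_max_right _ _) im
  simp only [hM'] at hρm
  set Tp : α × ℝ → ℝ := fun p => quantile (ρp p.1) p.2 with hTpdef
  set Tm : α × ℝ → ℝ := fun p => quantile (ρm p.1) p.2 with hTmdef
  have hTp : Measurable Tp := measurable_quantile_kernel ρp
  have hTm : Measurable Tm := measurable_quantile_kernel ρm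
  have hE : MeasurableSet {p | F p = G p} := measurableSet_eq_fun hF hG
  have hm0 : Measurable fun p => if F p = G p then (1 : ℝ) else 0 :=
    Measurable.ite hE measurable_const measurable_const
  obtain ⟨κ0, hκ0⟩ := exists_kernel_push hm0 (f := fun p => (F p, G p)) (by fun_prop)
  obtain ⟨κ1, hκ1⟩ := exists_kernel_push
    (r := fun p => M p.1 * (G (p.1, Tm p) - F (p.1, Tp p)) /
      ((G (p.1, Tm p) - G (p.1, Tp p)) * (F (p.1, Tp p) - G (p.1, Tp p))))
    (f := fun p => (F (p.1, Tp p), G (p.1, Tp p))) (by fun_prop) (by fun_prop)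
  obtain ⟨κ2, hκ2⟩ := exists_kernel_push (r := fun p => M p.1 / (G (p.1, Tm p) - G (p.1, Tp p)))
    (f := fun p => (F (p.1, Tp p), G (p.1, Tm p))) (by fun_prop) (by fun_prop)
  obtain ⟨κ3, hκ3⟩ := exists_kernel_push (r := fun p => M p.1 / (G (p.1, Tm p) - G (p.1, Tp p)))
    (f := fun p => (F (p.1, Tm p), G (p.1, Tp p))) (by fun_prop) (by fun_prop)
  obtain ⟨κ4, hκ4⟩ := exists_kernel_push
    (r := fun p => M p.1 * (F (p.1, Tm p) - G (p.1, Tp p)) /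
      ((G (p.1, Tm p) - G (p.1, Tp p)) * (G (p.1, Tm p) - F (p.1, Tm p))))
    (f := fun p => (F (p.1, Tm p), G (p.1, Tm p))) (by fun_prop) (by fun_prop)
  have hπ : ∀ a, (κ0 + (κ1 + (κ2 + (κ3 + κ4)))) a = fourPoint (fun t => F (a, t))
      (fun t => G (a, t)) (fun t => Tp (a, t)) (fun t => Tm (a, t)) (M a) := fun a => by
    simp only [add_apply, hκ0, hκ1, hκ2, hκ3, hκ4, fourPoint]
  have hFa : ∀ a, Measurable fun t => F (a, t) := fun a => hF.comp measurable_prodMk_left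
  have hGa : ∀ a, Measurable fun t => G (a, t) := fun a => hG.comp measurable_prodMk_left
  have hTpa : ∀ a, Measurable fun t => Tp (a, t) := fun a => hTp.comp measurable_prodMk_left
  have hTma : ∀ a, Measurable fun t => Tm (a, t) := fun a => hTm.comp measurable_prodMk_left
  -- Nonnegativity of the partial integrals of `F - G` says that the excess of `F` lies to the left
  -- of its deficit: `ρp` is stochastically below `ρm`, hence `Tp ≤ Tm`.
  have hcdf : ∀ a, 0 < M a → ∀ x, cdf (ρm a) x ≤ cdf (ρp a) x := fun a ha x => by
    have hpos : 0 ≤ ∫ t in Iic x,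
        (max (F (a, t) - G (a, t)) 0 - max (G (a, t) - F (a, t)) 0) ∂unif := by
      simp only [hdiff]
      exact setIntegral_quantile_sub_nonneg (hμ a) (hν a) (hmean a) (hsq a) x
    rw [integral_sub (ip a).restrict (im a).restrict] at hpos
    have hset : ∀ g : ℝ → ℝ, (∀ t, 0 ≤ g t) → Integrable g unif →
        ∫⁻ t, ENNReal.ofReal (g t) * (Iic x).indicator 1 t ∂unif =
          ENNReal.ofReal (∫ t in Iic x, g t ∂unif) := fun g hg0 hgi => by
      rw [ofReal_integral_eq_lintegral_ofReal hgi.restrict (ae_of_all _ hg0),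
        ← lintegral_indicator measurableSet_Iic]
      refine lintegral_congr fun t => ?_
      by_cases ht : t ∈ Iic x <;> simp [indicator, ht]
    have h1 := hρp a ha.ne' ((Iic x).indicator 1) (measurable_one.indicator measurableSet_Iic)
    have h2 := hρm a ha.ne' ((Iic x).indicator 1) (measurable_one.indicator measurableSet_Iic)
    rw [lintegral_indicator_one measurableSet_Iic, ← ofReal_cdf,
      hset _ (fun t => le_max_right _ _) (ip a), ← ENNReal.ofReal_mul (hM0 a)] at h1
    rw [lintegral_indicator_one measurableSet_Iic, ← ofReal_cdf,
      hset _ (fun t => le_max_right _ _) (im a), ← ENNReal.ofReal_mul (hM0 a)] at h2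
    have h1' := (ENNReal.ofReal_eq_ofReal_iff (mul_nonneg (hM0 a) (cdf_nonneg _ _))
      (integral_nonneg fun t => le_max_right _ _)).1 h1
    have h2' := (ENNReal.ofReal_eq_ofReal_iff (mul_nonneg (hM0 a) (cdf_nonneg _ _))
      (integral_nonneg fun t => le_max_right _ _)).1 h2
    simp only [Pi.zero_apply] at h1' h2'
    exact le_of_mul_le_mul_left (by linarith : M a * cdf (ρm a) x ≤ M a * cdf (ρp a) x) ha
  have hord : ∀ a, ∀ᵐ t ∂unif, M a = 0 ∨ (G (a, Tp (a, t)) < F (a, Tp (a, t)) ∧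
      F (a, Tp (a, t)) ≤ F (a, Tm (a, t)) ∧ F (a, Tm (a, t)) < G (a, Tm (a, t))) := fun a => by
    rcases (hM0 a).eq_or_lt with h | h
    · exact ae_of_all _ fun t => Or.inl h.symm
    have hgp := ae_pos_of_normalized (g := fun t => max (F (a, t) - G (a, t)) 0)
      (((hFa a).sub (hGa a)).max measurable_const) h (hρp a h.ne')
    have hgm := ae_pos_of_normalized (g := fun t => max (G (a, t) - F (a, t)) 0)
      (((hGa a).sub (hFa a)).max measurable_const) h (hρm a h.ne')
    filter_upwards [hgp, hgm, ae_restrict_mem measurableSet_Ioo] with t ⟨h1, h2⟩ ⟨h3, h4⟩ ht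
    refine Or.inr ⟨?_, ?_, ?_⟩
    · simpa using h2
    · exact monotoneOn_quantile (μ a) h1 h3 ((quantile_le_iff (ρp a) ht _).2
        (((quantile_le_iff (ρm a) ht _).1 le_rfl).trans (hcdf a h _)))
    · simpa using h4
  -- When `M a = 0` the off-diagonal weights vanish, and the diagonal part must carry all the mass.
  have hdeg : ∀ a, M a = 0 → ∀ᵐ t ∂unif, F (a, t) = G (a, t) := fun a ha => by
    have h1 := (integral_eq_zero_iff_of_nonneg (fun t => le_max_right _ _) (ip a)).1 ha
    have h2 := (integral_eq_zero_iff_of_nonneg (fun t => le_max_right _ _) (im a)).1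
      ((hM' a).trans ha)
    filter_upwards [h1, h2] with t h1 h2
    have h3 := hdiff a t
    simp only [Pi.zero_apply] at h1 h2
    rw [h1, h2] at h3
    linarith
  have hp : ∀ a, ∀ H : ℝ → ENNReal, Measurable H →
      ∫⁻ t, ENNReal.ofReal (M a / (F (a, Tp (a, t)) - G (a, Tp (a, t)))) * H (Tp (a, t)) ∂unif =
        ∫⁻ t, {s | G (a, s) < F (a, s)}.indicator H t ∂unif := fun a H hH => by
    rcases (hM0 a).eq_or_lt with h | h
    · rw [← h]
      simp only [zero_div, ENNReal.ofReal_zero, zero_mul, lintegral_zero]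
      symm
      refine lintegral_eq_zero_of_ae_eq_zero ?_
      filter_upwards [hdeg a h.symm] with t ht
      exact indicator_of_notMem (by simp [ht]) _
    · have := lintegral_normalized (g := fun t => max (F (a, t) - G (a, t)) 0)
        (((hFa a).sub (hGa a)).max measurable_const) (fun t => le_max_right _ _) h
        (hρp a h.ne') hH
      simp only [lt_max_iff, lt_irrefl, or_false, sub_pos] at this
      rw [← this]
      refine lintegral_congr_ae ?_
      filter_upwards [hord a] with t ht
      rcases ht with ht | ht
      · exact absurd ht h.ne'
      · simp only [hTpdef] at ht ⊢
        rw [max_eq_left (by linarith [ht.1])]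
  have hm : ∀ a, ∀ H : ℝ → ENNReal, Measurable H →
      ∫⁻ t, ENNReal.ofReal (M a / (G (a, Tm (a, t)) - F (a, Tm (a, t)))) * H (Tm (a, t)) ∂unif =
        ∫⁻ t, {s | F (a, s) < G (a, s)}.indicator H t ∂unif := fun a H hH => by
    rcases (hM0 a).eq_or_lt with h | h
    · rw [← h]
      simp only [zero_div, ENNReal.ofReal_zero, zero_mul, lintegral_zero]
      symm
      refine lintegral_eq_zero_of_ae_eq_zero ?_
      filter_upwards [hdeg a h.symm] with t ht
      exact indicator_of_notMem (by simp [ht]) _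
    · have := lintegral_normalized (g := fun t => max (G (a, t) - F (a, t)) 0)
        (((hGa a).sub (hFa a)).max measurable_const) (fun t => le_max_right _ _) h
        (hρm a h.ne') hH
      simp only [lt_max_iff, lt_irrefl, or_false, sub_pos] at this
      rw [← this]
      refine lintegral_congr_ae ?_
      filter_upwards [hord a] with t ht
      rcases ht with ht | ht
      · exact absurd ht h.ne'
      · simp only [hTmdef] at ht ⊢
        rw [max_eq_left (by linarith [ht.2.2])]
  refine ⟨κ0 + (κ1 + (κ2 + (κ3 + κ4))), fun a => ?_, fun a => ?_, fun a s hs => ?_⟩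
  · rw [hπ, map_fst_fourPoint (hFa a) (hGa a) (hTpa a) (hTma a) (hM0 a) (hord a) (hp a) (hm a)]
    exact map_quantile (μ a)
  · rw [hπ, map_snd_fourPoint (hFa a) (hGa a) (hTpa a) (hTma a) (hM0 a) (hord a) (hp a) (hm a)]
    exact map_quantile (ν a)
  · rw [hπ]
    exact integral_fourPoint (hFa a) (hGa a) (hTpa a) (hTma a) (hM0 a) (hord a) (hp a) (hm a)
      (iF a) (iG a) hs

/-- Gluing a kernel of martingale couplings of `φ (a, Z)` and `Y` with the law of `Z`. -/
theorem exists_glued_kernel {α E : Type*} [MeasurableSpace α] [MeasurableSpace E]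
    (κ₁ : Kernel α E) [IsMarkovKernel κ₁] {φ : α × E → ℝ} (hφ : Measurable φ)
    (π : Kernel α (ℝ × ℝ)) (hfst : ∀ a, (π a).map Prod.fst = (κ₁ a).map fun z => φ (a, z))
    (hi1 : ∀ a, Integrable (fun w => w.1) (π a)) (hi2 : ∀ a, Integrable (fun w => w.2) (π a))
    (hmart : ∀ a s, MeasurableSet s → ∫ w in Prod.fst ⁻¹' s, (w.2 - w.1) ∂(π a) = 0) :
    ∃ κ : Kernel α (E × ℝ), IsMarkovKernel κ ∧ (∀ a, (κ a).map Prod.fst = κ₁ a) ∧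
      (∀ a, (κ a).map Prod.snd = (π a).map Prod.snd) ∧
      ∀ a s, MeasurableSet s →
        ∫ w in Prod.fst ⁻¹' s, w.2 ∂(κ a) = ∫ w in Prod.fst ⁻¹' s, φ (a, w.1) ∂(κ a) := by
  have hφa : ∀ a, Measurable fun z => φ (a, z) := fun a => hφ.comp measurable_prodMk_left
  have hπ : IsMarkovKernel π := ⟨fun a => ⟨by
    have := Measure.isProbabilityMeasure_map (μ := κ₁ a) (hφa a).aemeasurable
    rw [← preimage_univ (f := Prod.fst), ← Measure.map_apply measurable_fst MeasurableSet.univ,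
      hfst, measure_univ]⟩⟩
  set K := π.condKernel with hK
  have hg : Measurable fun p : α × E => (p.1, φ p) := measurable_fst.prodMk hφ
  -- `Z` is drawn first, then `Y` from its law under `π` given the value `φ (a, Z)`; thus `Y`
  -- depends on `Z` only through that value.
  set κ : Kernel α (E × ℝ) := κ₁ ⊗ₖ (K.comap (fun p : α × E => (p.1, φ p)) hg) with hκ
  have hκfst : ∀ a, (κ a).map Prod.fst = κ₁ a := fun a => by
    rw [← Kernel.fst_apply, hκ, Kernel.fst_compProd]
  have hκsnd : ∀ a, (κ a).map Prod.snd = (π a).map Prod.snd := fun a => by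
    refine Measure.ext_of_lintegral _ fun h hh => ?_
    have hm : Measurable fun v => ∫⁻ y, h y ∂K (a, v) :=
      hh.lintegral_kernel.comp measurable_prodMk_left
    have hc := Kernel.lintegral_compProd κ₁ (K.comap (fun p : α × E => (p.1, φ p)) hg) a
      (f := fun w : E × ℝ => h w.2) (hh.comp measurable_snd)
    rw [lintegral_map hh measurable_snd, lintegral_map hh measurable_snd, hκ, hc]
    simp only [Kernel.comap_apply]
    rw [← lintegral_map (f := fun v => ∫⁻ y, h y ∂K (a, v)) hm (hφa a), ← hfst,
      ← Kernel.fst_apply]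
    exact lintegral_condKernel (κ := π) (f := fun w : ℝ × ℝ => h w.2)
      (hh.comp measurable_snd) a
  -- The integrated martingale identity determines the mean of the conditional kernel almost surely.
  have hmean : ∀ a, ∀ᵐ v ∂(Kernel.fst π a), ∫ y, y ∂K (a, v) = v := fun a => by
    have hI : Integrable (fun v => ∫ y, y ∂K (a, v)) (Kernel.fst π a) := by
      have := hi2 a
      rw [← π.disintegrate π.condKernel] at this
      exact this.integral_compProd
    have hI1 : Integrable (fun v : ℝ => v) (Kernel.fst π a) := by
      rw [Kernel.fst_apply]
      exact (integrable_map_measure aestronglyMeasurable_id measurable_fst.aemeasurable).2 (hi1 a)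
    refine hI.ae_eq_of_forall_setIntegral_eq _ _ hI1 fun s hs _ => ?_
    have h1 := setIntegral_condKernel (κ := π) (f := fun w : ℝ × ℝ => w.2) a hs
      MeasurableSet.univ (hi2 a).integrableOn
    simp only [Measure.restrict_univ] at h1
    rw [h1, Kernel.fst_apply, setIntegral_map (f := fun x : ℝ => x) hs aestronglyMeasurable_id
      measurable_fst.aemeasurable, prod_univ]
    have h2 := hmart a s hs
    rw [integral_sub (hi2 a).restrict (hi1 a).restrict] at h2
    simpa using sub_eq_zero.1 h2
  refine ⟨κ, inferInstance, hκfst, hκsnd, fun a s hs => ?_⟩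
  have hi : Integrable (fun w : E × ℝ => w.2) (κ a) := by
    refine (integrable_map_measure (g := fun x : ℝ => x) aestronglyMeasurable_id
      measurable_snd.aemeasurable).1 ?_
    rw [hκsnd]
    exact (integrable_map_measure aestronglyMeasurable_id measurable_snd.aemeasurable).2 (hi2 a)
  have h1 := setIntegral_compProd (κ := κ₁)
    (η := K.comap (fun p : α × E => (p.1, φ p)) hg) (f := fun w : E × ℝ => w.2) (a := a) hs
    MeasurableSet.univ hi.integrableOn
  simp only [Measure.restrict_univ, prod_univ, Kernel.comap_apply] at h1
  have h2 : ∀ᵐ z ∂(κ₁ a), ∫ y, y ∂K (a, φ (a, z)) = φ (a, z) := by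
    have := hmean a
    rw [Kernel.fst_apply, hfst] at this
    exact ae_of_ae_map (hφa a).aemeasurable this
  rw [hκ, h1, ← hκ, setIntegral_congr_ae hs (by filter_upwards [h2] with z hz _ using hz)]
  conv_lhs => rw [← hκfst a]
  rw [setIntegral_map hs (hφa a).aestronglyMeasurable measurable_fst.aemeasurable]

lemma exists_kernel_map {α E F : Type*} [MeasurableSpace α] [MeasurableSpace E]
    [MeasurableSpace F] (κ : Kernel α E) [IsMarkovKernel κ] {φ : α × E → F} (hφ : Measurable φ) :
    ∃ η : Kernel α F, IsMarkovKernel η ∧ ∀ a, η a = (κ a).map fun z => φ (a, z) := by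
  refine ⟨(Kernel.id ×ₖ κ).map φ, Kernel.IsMarkovKernel.map _ hφ, fun a => ?_⟩
  rw [Kernel.map_apply _ hφ, Kernel.prod_apply, Kernel.id_apply, Measure.dirac_prod,
    Measure.map_map hφ measurable_prodMk_left]
  rfl

/-! ### Residual laws and necessity of the convex order -/

section Laws

variable {d p : ℕ} {κY : Kernel (EuclideanSpace ℝ (Fin d)) ℝ}
  {κX : Kernel (EuclideanSpace ℝ (Fin d)) (EuclideanSpace ℝ (Fin p))}
  {x : EuclideanSpace ℝ (Fin d)} {β : EuclideanSpace ℝ (Fin p)}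

variable (κY) in
/-- The law of `Y^x` given `X_c = x`. -/
noncomputable def lawY (x : EuclideanSpace ℝ (Fin d)) : Measure ℝ :=
  (κY x).map fun y => y - meanY κY x

variable (κX) in
/-- The law of `X^x' β` given `X_c = x`. -/
noncomputable def lawX (x : EuclideanSpace ℝ (Fin d)) (β : EuclideanSpace ℝ (Fin p)) : Measure ℝ :=
  (κX x).map fun z => inner ℝ (z - meanX κX x) β

lemma integral_call_lawY (k : ℝ) : ∫ y, max (y - k) 0 ∂(lawY κY x) =
    ∫ y, max (y - meanY κY x - k) 0 ∂(κY x) := by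
  rw [lawY, integral_map (by fun_prop) (by fun_prop)]

lemma integral_call_lawX (k : ℝ) : ∫ y, max (y - k) 0 ∂(lawX κX x β) =
    ∫ z, max (inner ℝ (z - meanX κX x) β - k) 0 ∂(κX x) := by
  rw [lawX, integral_map (by fun_prop) (by fun_prop)]

variable [IsMarkovKernel κY] [IsMarkovKernel κX]

instance : IsProbabilityMeasure (lawY κY x) :=
  Measure.isProbabilityMeasure_map (by fun_prop)

instance : IsProbabilityMeasure (lawX κX x β) :=
  Measure.isProbabilityMeasure_map (by fun_prop)

lemma integrable_lawY (h : Integrable (fun y : ℝ => y) (κY x)) :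
    Integrable (fun y => y) (lawY κY x) :=
  (integrable_map_measure aestronglyMeasurable_id (by fun_prop)).2 (h.sub (integrable_const _))

lemma integrable_lawX (h : Integrable (fun z : EuclideanSpace ℝ (Fin p) => z) (κX x)) :
    Integrable (fun y => y) (lawX κX x β) :=
  (integrable_map_measure aestronglyMeasurable_id (by fun_prop)).2
    ((h.sub (integrable_const _)).inner_const β)

lemma integral_lawY (h : Integrable (fun y : ℝ => y) (κY x)) : ∫ y, y ∂(lawY κY x) = 0 := by
  rw [lawY, integral_map (by fun_prop) (by fun_prop), integral_sub h (integrable_const _)]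
  simp [meanY]

lemma integral_inner_const {E : Type*} [MeasurableSpace E] {μ : Measure E}
    {g : E → EuclideanSpace ℝ (Fin p)} (h : Integrable g μ) (β : EuclideanSpace ℝ (Fin p)) :
    ∫ z, inner ℝ (g z) β ∂μ = inner ℝ (∫ z, g z ∂μ) β := by
  simp_rw [real_inner_comm]
  exact integral_inner h β

lemma integral_lawX (h : Integrable (fun z : EuclideanSpace ℝ (Fin p) => z) (κX x)) :
    ∫ y, y ∂(lawX κX x β) = 0 := by
  rw [lawX, integral_map (by fun_prop) (by fun_prop),
    integral_inner_const (g := fun z => z - meanX κX x) (h.sub (integrable_const _)),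
    integral_sub h (integrable_const _)]
  simp [meanX]

/-- A law on `ℝ × E` with `E(Y | X) = m + X'β` determines `m` and satisfies Jensen's inequality. -/
lemma of_condExp {κ : Measure (ℝ × EuclideanSpace ℝ (Fin p))} [IsProbabilityMeasure κ] {m : ℝ}
    (hfst : Integrable (fun w => w.1) κ) (hsnd : Integrable (fun w => w.2) κ)
    (hc : κ[Prod.fst | MeasurableSpace.comap Prod.snd inferInstance]
      =ᵐ[κ] fun w => m + inner ℝ w.2 β) :
    m = ∫ w, w.1 ∂κ - inner ℝ (∫ w, w.2 ∂κ) β ∧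
      ∀ k, ∫ w, max (m + inner ℝ w.2 β - k) 0 ∂κ ≤ ∫ w, max (w.1 - k) 0 ∂κ := by
  have hm : MeasurableSpace.comap Prod.snd inferInstance ≤
      (inferInstance : MeasurableSpace (ℝ × EuclideanSpace ℝ (Fin p))) :=
    measurable_snd.comap_le
  have hg : Integrable (fun w : ℝ × EuclideanSpace ℝ (Fin p) => m + inner ℝ w.2 β) κ :=
    (integrable_const m).add (hsnd.inner_const β)
  have key : ∀ s : Set (EuclideanSpace ℝ (Fin p)), MeasurableSet s →
      ∫ w in Prod.snd ⁻¹' s, (m + inner ℝ w.2 β) ∂κ = ∫ w in Prod.snd ⁻¹' s, w.1 ∂κ :=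
    fun s hs => by
      rw [← setIntegral_condExp hm hfst ⟨s, hs, rfl⟩]
      exact setIntegral_congr_ae (measurable_snd hs) (by
        filter_upwards [hc] with w hw _ using hw.symm)
  constructor
  · have := key univ MeasurableSet.univ
    simp only [preimage_univ, Measure.restrict_univ] at this
    rw [integral_add (integrable_const m) (hsnd.inner_const β), integral_inner_const hsnd] at this
    simp only [integral_const, probReal_univ, one_smul] at this
    linarith
  · intro k
    -- This event depends on `X` alone, so on it the conditional mean can be replaced by `Y` under
    -- the integral; `Y - k` is then bounded by its positive part.
    set s : Set (EuclideanSpace ℝ (Fin p)) := {z | 0 < m + inner ℝ z β - k} with hsdef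
    have hs : MeasurableSet s := measurableSet_lt measurable_const (by fun_prop)
    have hs' : MeasurableSet (Prod.snd ⁻¹' s : Set (ℝ × EuclideanSpace ℝ (Fin p))) :=
      measurable_snd hs
    have h1 : ∫ w, max (m + inner ℝ w.2 β - k) 0 ∂κ =
        ∫ w in Prod.snd ⁻¹' s, (m + inner ℝ w.2 β - k) ∂κ := by
      rw [← integral_indicator hs']
      refine integral_congr_ae (ae_of_all _ fun w => ?_)
      by_cases hw : w ∈ (Prod.snd ⁻¹' s : Set (ℝ × EuclideanSpace ℝ (Fin p)))
      · simp only [indicator_of_mem hw]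
        exact max_eq_left (le_of_lt hw)
      · simp only [indicator_of_notMem hw]
        exact max_eq_right (not_lt.1 hw)
    have hcall : Integrable (fun w : ℝ × EuclideanSpace ℝ (Fin p) => max (w.1 - k) 0) κ :=
      (hfst.sub (integrable_const k)).pos_part
    rw [h1, integral_sub hg.restrict (integrable_const k), key s hs,
      ← integral_sub hfst.restrict (integrable_const k)]
    calc _ ≤ ∫ w in Prod.snd ⁻¹' s, max (w.1 - k) 0 ∂κ :=
          integral_mono (hfst.restrict.sub (integrable_const k)) hcall.restrict
            fun w => le_max_left _ _
      _ ≤ _ := setIntegral_le_integral hcall (ae_of_all _ fun w => le_max_right _ _)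

variable {T : Set (EuclideanSpace ℝ (Fin d))}

omit [IsMarkovKernel κY] [IsMarkovKernel κX] in
lemma Compatible.eq_and_call {f : T → ℝ}
    (hY : ∀ x ∈ T, Integrable (fun y : ℝ => y) (κY x))
    (hX : ∀ x ∈ T, Integrable (fun z : EuclideanSpace ℝ (Fin p) => z) (κX x))
    (h : Compatible T κY κX β f) :
    f = (fun x : T => meanY κY x - inner ℝ (meanX κX x) β) ∧
      ∀ x ∈ T, ∀ k, ∫ y, max (y - k) 0 ∂(lawX κX x β) ≤ ∫ y, max (y - k) 0 ∂(lawY κY x) := by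
  obtain ⟨κ, hκ, h⟩ := h
  have main : ∀ x : T, f x = meanY κY x - inner ℝ (meanX κX x) β ∧
      ∀ k, ∫ y, max (y - k) 0 ∂(lawX κX x β) ≤ ∫ y, max (y - k) 0 ∂(lawY κY x) := fun x => by
    obtain ⟨h1, h2, h3⟩ := h x
    have i1 : Integrable (fun w => w.1) (κ x) :=
      (integrable_map_measure (g := fun y : ℝ => y) aestronglyMeasurable_id
        measurable_fst.aemeasurable).1 (h1 ▸ hY x x.2)
    have i2 : Integrable (fun w => w.2) (κ x) :=
      (integrable_map_measure (g := fun y : EuclideanSpace ℝ (Fin p) => y) aestronglyMeasurable_id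
        measurable_snd.aemeasurable).1 (h2 ▸ hX x x.2)
    obtain ⟨h4, h5⟩ := of_condExp i1 i2 h3
    have e1 : ∫ w, w.1 ∂(κ x) = meanY κY x := by
      rw [meanY, ← h1, integral_map (by fun_prop) (by fun_prop)]
    have e2 : ∫ w, w.2 ∂(κ x) = meanX κX x := by
      rw [meanX, ← h2, integral_map (by fun_prop) (by fun_prop)]
    rw [e1, e2] at h4
    refine ⟨h4, fun k => ?_⟩
    rw [integral_call_lawX, integral_call_lawY, ← h1, ← h2,
      integral_map (by fun_prop) (by fun_prop), integral_map (by fun_prop) (by fun_prop)]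
    -- Centering `Y` moves the threshold by its mean.
    convert h5 (k + meanY κY x) using 4 with w w
    · rw [h4, inner_sub_left]; ring
    · ring
  exact ⟨funext fun x => (main x).1, fun x hx => (main ⟨x, hx⟩).2⟩

end Laws

/-! ### Sufficiency of the superquantile order -/

section Construction

variable {d p : ℕ} {κY : Kernel (EuclideanSpace ℝ (Fin d)) ℝ}
  {κX : Kernel (EuclideanSpace ℝ (Fin d)) (EuclideanSpace ℝ (Fin p))}
  {β : EuclideanSpace ℝ (Fin p)} [IsMarkovKernel κY] [IsMarkovKernel κX]
  {T : Set (EuclideanSpace ℝ (Fin d))}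

omit [IsMarkovKernel κY] [IsMarkovKernel κX] in
lemma measurable_meanY : Measurable (meanY κY) := by
  have : StronglyMeasurable (meanY κY) := stronglyMeasurable_id.integral_kernel
  exact this.measurable

omit [IsMarkovKernel κY] [IsMarkovKernel κX] in
lemma measurable_meanX : Measurable (meanX κX) := by
  have : StronglyMeasurable (meanX κX) := stronglyMeasurable_id.integral_kernel
  exact this.measurable

/-- If the law of `X^x'β` is dominated by that of `Y^x` in the sense of superquantiles for every
`x`, then `β` is compatible with the model. -/
theorem compatible_of_superquantile (hT : MeasurableSet T)
    (hY : ∀ x ∈ T, Integrable (fun y : ℝ => y) (κY x))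
    (hX : ∀ x ∈ T, Integrable (fun z : EuclideanSpace ℝ (Fin p) => z) (κX x))
    (hsq : ∀ x ∈ T, ∀ u ∈ Ioo (0 : ℝ) 1,
      ∫ t in u..1, genInv (cdf (lawX κX x β)) t ≤ ∫ t in u..1, genInv (cdf (lawY κY x)) t) :
    Compatible T κY κX β (fun x : T => meanY κY x - inner ℝ (meanX κX x) β) := by
  have hmY : Measurable (meanY κY) := measurable_meanY
  have hmX : Measurable (meanX κX) := measurable_meanX
  -- The indicators replace both residual laws by the point mass at zero outside `T`, so that the
  -- kernel theorem applies at every parameter.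
  set φ : EuclideanSpace ℝ (Fin d) × EuclideanSpace ℝ (Fin p) → ℝ :=
    (Prod.fst ⁻¹' T).indicator fun q => inner ℝ (q.2 - meanX κX q.1) β with hφdef
  set ψ : EuclideanSpace ℝ (Fin d) × ℝ → ℝ :=
    (Prod.fst ⁻¹' T).indicator fun q => q.2 - meanY κY q.1 with hψdef
  have hφ : Measurable φ := Measurable.indicator (by fun_prop) (measurable_fst hT)
  have hψ : Measurable ψ := Measurable.indicator (by fun_prop) (measurable_fst hT)
  have hφa : ∀ a, Measurable fun z => φ (a, z) := fun a => hφ.comp measurable_prodMk_left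
  have hφT : ∀ x ∈ T, ∀ z, φ (x, z) = inner ℝ (z - meanX κX x) β := fun x hx z => by
    simp [hφdef, hx]
  have hψT : ∀ x ∈ T, ∀ y, ψ (x, y) = y - meanY κY x := fun x hx y => by
    simp [hψdef, hx]
  have hφ0 : ∀ x, x ∉ T → ∀ z, φ (x, z) = 0 := fun x hx z => by
    simp [hφdef, hx]
  have hψ0 : ∀ x, x ∉ T → ∀ y, ψ (x, y) = 0 := fun x hx y => by
    simp [hψdef, hx]
  obtain ⟨μ, _, hμ⟩ := exists_kernel_map κX hφ
  obtain ⟨ν, _, hν⟩ := exists_kernel_map κY hψ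
  have hμT : ∀ x ∈ T, μ x = lawX κX x β := fun x hx => by
    rw [hμ, lawX]; simp_rw [hφT x hx]
  have hνT : ∀ x ∈ T, ν x = lawY κY x := fun x hx => by
    rw [hν, lawY]; simp_rw [hψT x hx]
  have hμ0 : ∀ x, x ∉ T → μ x = Measure.dirac 0 := fun x hx => by
    rw [hμ]; simp_rw [hφ0 x hx]; simp [Measure.map_const]
  have hν0 : ∀ x, x ∉ T → ν x = Measure.dirac 0 := fun x hx => by
    rw [hν]; simp_rw [hψ0 x hx]; simp [Measure.map_const]
  have iμ : ∀ a, Integrable (fun y : ℝ => y) (μ a) := fun a => by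
    by_cases ha : a ∈ T
    · rw [hμT a ha]; exact integrable_lawX (hX a ha)
    · rw [hμ0 a ha]; exact integrable_dirac (by simp)
  have iν : ∀ a, Integrable (fun y : ℝ => y) (ν a) := fun a => by
    by_cases ha : a ∈ T
    · rw [hνT a ha]; exact integrable_lawY (hY a ha)
    · rw [hν0 a ha]; exact integrable_dirac (by simp)
  obtain ⟨π, hπ1, hπ2, hmart⟩ := exists_martingale_kernel μ ν iμ iν (fun a => by
    by_cases ha : a ∈ T
    · rw [hμT a ha, hνT a ha, integral_lawX (hX a ha), integral_lawY (hY a ha)]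
    · rw [hμ0 a ha, hν0 a ha]) (fun a u hu => by
    by_cases ha : a ∈ T
    · rw [hμT a ha, hνT a ha]; exact hsq a ha u hu
    · rw [hμ0 a ha, hν0 a ha])
  obtain ⟨κ, _, hκ1, hκ2, hκ3⟩ := exists_glued_kernel κX hφ π
    (fun a => by rw [hπ1, hμ])
    (fun a => (integrable_map_measure (g := fun y : ℝ => y) aestronglyMeasurable_id
      measurable_fst.aemeasurable).1 (by rw [hπ1]; exact iμ a))
    (fun a => (integrable_map_measure (g := fun y : ℝ => y) aestronglyMeasurable_id
      measurable_snd.aemeasurable).1 (by rw [hπ2]; exact iν a)) hmart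
  obtain ⟨η, hηM, hη⟩ := exists_kernel_map κ
    (φ := fun q : EuclideanSpace ℝ (Fin d) × (EuclideanSpace ℝ (Fin p) × ℝ) =>
      (q.2.2 + meanY κY q.1, q.2.1)) (by fun_prop)
  refine ⟨η, hηM, fun ⟨x, hx⟩ => ?_⟩
  have hη1 : (η x).map Prod.fst = κY x := by
    rw [hη, Measure.map_map measurable_fst (by fun_prop)]
    have : (Prod.fst ∘ fun z : EuclideanSpace ℝ (Fin p) × ℝ => (z.2 + meanY κY x, z.1)) =
      (fun y : ℝ => y + meanY κY x) ∘ Prod.snd := rfl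
    rw [this, ← Measure.map_map (by fun_prop) measurable_snd, hκ2, hπ2, hνT x hx, lawY,
      Measure.map_map (by fun_prop) (by fun_prop)]
    have : (fun y : ℝ => y + meanY κY x) ∘ (fun y => y - meanY κY x) = id := by ext y; simp
    rw [this, Measure.map_id]
  have hη2 : (η x).map Prod.snd = κX x := by
    rw [hη, Measure.map_map measurable_snd (by fun_prop)]
    exact hκ1 x
  refine ⟨hη1, hη2, ?_⟩
  have hm : MeasurableSpace.comap Prod.snd inferInstance ≤
      (inferInstance : MeasurableSpace (ℝ × EuclideanSpace ℝ (Fin p))) :=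
    measurable_snd.comap_le
  have i1 : Integrable (fun w => w.1) (η x) :=
    (integrable_map_measure (g := fun y : ℝ => y) aestronglyMeasurable_id
      measurable_fst.aemeasurable).1 (by rw [hη1]; exact hY x hx)
  have i2 : Integrable (fun w => w.2) (η x) :=
    (integrable_map_measure (g := fun y : EuclideanSpace ℝ (Fin p) => y) aestronglyMeasurable_id
      measurable_snd.aemeasurable).1 (by rw [hη2]; exact hX x hx)
  have ig : Integrable (fun w : ℝ × EuclideanSpace ℝ (Fin p) =>
      meanY κY x - inner ℝ (meanX κX x) β + inner ℝ w.2 β) (η x) :=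
    (integrable_const _).add (i2.inner_const β)
  have hmeas : Measurable fun z : EuclideanSpace ℝ (Fin p) × ℝ => (z.2 + meanY κY x, z.1) := by
    fun_prop
  have iκ2 : Integrable (fun w => w.2) (κ x) :=
    (integrable_map_measure (g := fun y : ℝ => y) aestronglyMeasurable_id
      measurable_snd.aemeasurable).1 (by rw [hκ2, hπ2]; exact iν x)
  have iκ1 : Integrable (fun w => φ (x, w.1)) (κ x) :=
    (integrable_map_measure (g := fun z => φ (x, z)) (hφa x).aestronglyMeasurable
      measurable_fst.aemeasurable).1 (by
        rw [hκ1]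
        refine (integrable_map_measure (g := fun y : ℝ => y) aestronglyMeasurable_id
          (hφa x).aemeasurable).1 ?_
        rw [← hμ]; exact iμ x)
  refine (ae_eq_condExp_of_forall_setIntegral_eq hm i1 (fun s _ _ => ig.integrableOn) ?_ ?_).symm
  · rintro _ ⟨s, hs, rfl⟩ _
    have hs2 : MeasurableSet (Prod.snd ⁻¹' s : Set (ℝ × EuclideanSpace ℝ (Fin p))) :=
      measurable_snd hs
    have h1 := hκ3 x s hs
    rw [hη, setIntegral_map hs2 (by fun_prop) hmeas.aemeasurable,
      setIntegral_map hs2 (by fun_prop) hmeas.aemeasurable]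
    have hpre : (fun z : EuclideanSpace ℝ (Fin p) × ℝ => (z.2 + meanY κY x, z.1)) ⁻¹'
      (Prod.snd ⁻¹' s) = Prod.fst ⁻¹' s := rfl
    simp only [hpre]
    rw [integral_add iκ2.restrict (integrable_const _), h1,
      ← integral_add iκ1.restrict (integrable_const _)]
    refine integral_congr_ae (ae_of_all _ fun w => ?_)
    simp only [hφT x hx, inner_sub_left]
    ring
  · refine StronglyMeasurable.aestronglyMeasurable ?_
    have : Measurable[MeasurableSpace.comap Prod.snd inferInstance]
        fun w : ℝ × EuclideanSpace ℝ (Fin p) =>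
          meanY κY x - inner ℝ (meanX κX x) β + inner ℝ w.2 β :=
      (by fun_prop : Measurable fun z : EuclideanSpace ℝ (Fin p) =>
        meanY κY x - inner ℝ (meanX κX x) β + inner ℝ z β).comp (comap_measurable _)
    exact this.stronglyMeasurable

end Construction

/-! ### The perturbed ratios of the shape bounds -/

section Limits

lemma tendsto_div_sq_atTop {a : ℝ} (ha : 0 ≤ a) :
    Tendsto (fun u : ℝ => (a + u) / u ^ 2) (𝓝[>] 0) atTop := by
  refine tendsto_atTop_mono' _ ?_ tendsto_inv_nhdsGT_zero
  filter_upwards [self_mem_nhdsWithin] with u hu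
  have hu' : (0 : ℝ) < u := hu
  rw [le_div_iff₀ (by positivity)]
  field_simp
  linarith

lemma tendsto_div_sq_atBot {a : ℝ} (ha : a < 0) :
    Tendsto (fun u : ℝ => (a + u) / u ^ 2) (𝓝[>] 0) atBot := by
  have h1 : Tendsto (fun u : ℝ => a + u) (𝓝[>] 0) (𝓝 a) := by
    have : Tendsto (fun u : ℝ => a + u) (𝓝 0) (𝓝 (a + 0)) := by
      exact (continuous_const.add continuous_id).tendsto 0
    rw [add_zero] at this
    exact this.mono_left nhdsWithin_le_nhds
  have h2 : Tendsto (fun u : ℝ => (u ^ 2)⁻¹) (𝓝[>] 0) atTop := by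
    have := (tendsto_inv_nhdsGT_zero (𝕜 := ℝ)).atTop_mul_atTop₀ tendsto_inv_nhdsGT_zero
    refine this.congr fun u => ?_
    rw [sq, mul_inv]
  exact h1.neg_mul_atTop ha h2

/-- For `b > 0` the limit is `a / b`. For `b = 0` it is `+∞` or `-∞` according to whether `a ≥ 0` or
`a < 0`, so the constraint `0 ≤ a` is either void or infeasible. At `a = b = 0` the ratio is `u /
u²`, which tends to `+∞`. -/
lemma le_limUnder_iff {a b : ℝ} (hb : 0 ≤ b) (l : ℝ) :
    (l : EReal) ≤ limUnder (𝓝[>] (0 : ℝ)) (fun u : ℝ => (((a + u) / (b + u ^ 2) : ℝ) : EReal)) ↔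
      l * b ≤ a := by
  rcases hb.eq_or_lt with rfl | hb
  · simp only [zero_add, mul_zero]
    rcases le_or_gt 0 a with ha | ha
    · rw [(EReal.tendsto_coe_nhds_top_iff.2 (tendsto_div_sq_atTop ha)).limUnder_eq]
      simp [ha]
    · rw [(EReal.tendsto_coe_nhds_bot_iff.2 (tendsto_div_sq_atBot ha)).limUnder_eq]
      simp [ha]
  · have h1 : Tendsto (fun u : ℝ => (a + u) / (b + u ^ 2)) (𝓝[>] 0) (𝓝 (a / b)) := by
      have : ContinuousAt (fun u : ℝ => (a + u) / (b + u ^ 2)) 0 :=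
        ContinuousAt.div (by fun_prop) (by fun_prop) (by simpa using hb.ne')
      have h := this.tendsto
      simp only [add_zero, ne_eq, OfNat.ofNat_ne_zero, not_false_eq_true, zero_pow] at h
      exact h.mono_left nhdsWithin_le_nhds
    rw [(EReal.tendsto_coe.2 h1).limUnder_eq, EReal.coe_le_coe_iff, le_div_iff₀ hb]

lemma limUnder_le_iff {a b : ℝ} (hb : b ≤ 0) (l : ℝ) :
    limUnder (𝓝[>] (0 : ℝ)) (fun u : ℝ => (((a + u) / (b - u ^ 2) : ℝ) : EReal)) ≤ (l : EReal) ↔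
      l * b ≤ a := by
  have hneg : ∀ u : ℝ, (a + u) / (b - u ^ 2) = -((a + u) / (-b + u ^ 2)) := fun u => by
    rw [← div_neg]; congr 1; ring
  simp only [hneg]
  rcases hb.eq_or_lt with rfl | hb
  · simp only [neg_zero, zero_add, mul_zero]
    rcases le_or_gt 0 a with ha | ha
    · have h : Tendsto (fun u : ℝ => -((a + u) / u ^ 2)) (𝓝[>] 0) atBot :=
        tendsto_neg_atTop_atBot.comp (tendsto_div_sq_atTop ha)
      rw [(EReal.tendsto_coe_nhds_bot_iff.2 h).limUnder_eq]
      simp [ha]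
    · have h : Tendsto (fun u : ℝ => -((a + u) / u ^ 2)) (𝓝[>] 0) atTop :=
        tendsto_neg_atBot_atTop.comp (tendsto_div_sq_atBot ha)
      rw [(EReal.tendsto_coe_nhds_top_iff.2 h).limUnder_eq]
      simp [ha]
  · have h1 : Tendsto (fun u : ℝ => -((a + u) / (-b + u ^ 2))) (𝓝[>] 0) (𝓝 (a / b)) := by
      have : ContinuousAt (fun u : ℝ => -((a + u) / (-b + u ^ 2))) 0 :=
        (ContinuousAt.div (by fun_prop) (by fun_prop) (by simpa using hb.ne)).neg
      have h := this.tendsto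
      simp only [add_zero, ne_eq, OfNat.ofNat_ne_zero, not_false_eq_true, zero_pow, div_neg,
        neg_neg] at h
      exact h.mono_left nhdsWithin_le_nhds
    rw [(EReal.tendsto_coe.2 h1).limUnder_eq, EReal.coe_le_coe_iff, div_le_iff_of_neg hb]

lemma lowerSc_le_and_le_upperSc_iff {I : Type*} (a b : I → ℝ) (l : ℝ) :
    (lowerSc a b ≤ (l : EReal) ∧ (l : EReal) ≤ upperSc a b) ↔ ∀ r, l * b r ≤ a r := by
  simp only [lowerSc, upperSc, iSup_le_iff, le_iInf_iff]
  constructor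
  · rintro ⟨h1, h2⟩ r
    rcases le_total (b r) 0 with h | h
    · exact (limUnder_le_iff h l).1 (h1 r h)
    · exact (le_limUnder_iff h l).1 (h2 r h)
  · exact fun h => ⟨fun r hr => (limUnder_le_iff hr l).2 (h r),
      fun r hr => (le_limUnder_iff hr l).2 (h r)⟩

end Limits

/-! ### Superquantiles along half-lines -/

section Radial

variable {d p : ℕ} {κY : Kernel (EuclideanSpace ℝ (Fin d)) ℝ}
  {κX : Kernel (EuclideanSpace ℝ (Fin d)) (EuclideanSpace ℝ (Fin p))}
  {x : EuclideanSpace ℝ (Fin d)} {β q : EuclideanSpace ℝ (Fin p)}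

lemma genInv_cdf_map_mul (μ : Measure ℝ) [IsProbabilityMeasure μ] {l : ℝ} (hl : 0 < l) (t : ℝ) :
    genInv (cdf (μ.map fun y => l * y)) t = l * genInv (cdf μ) t := by
  have := Measure.isProbabilityMeasure_map (μ := μ) (f := fun y => l * y) (by fun_prop)
  have hcdf : ∀ y, cdf (μ.map fun y => l * y) y = cdf μ (l⁻¹ * y) := fun y => by
    rw [cdf_eq_real, cdf_eq_real, map_measureReal_apply (by fun_prop) measurableSet_Iic]
    congr 1
    ext z
    simp only [mem_preimage, mem_Iic]
    rw [inv_mul_eq_div, le_div_iff₀ hl, mul_comm]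
  rw [genInv, genInv, ← smul_eq_mul, ← Real.sInf_smul_of_nonneg hl.le]
  congr 1
  ext y
  rw [mem_smul_set_iff_inv_smul_mem₀ hl.ne']
  simp [hcdf]

variable [IsMarkovKernel κY] [IsMarkovKernel κX]

omit [IsMarkovKernel κX] in
lemma lawX_smul (l : ℝ) : lawX κX x (l • q) = (lawX κX x q).map fun y => l * y := by
  rw [lawX, lawX, Measure.map_map (by fun_prop) (by fun_prop)]
  congr 1
  ext z
  simp [inner_smul_right]

lemma superquantile_lawX_smul {l : ℝ} (hl : 0 < l) (u : ℝ) :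
    ∫ t in u..1, genInv (cdf (lawX κX x (l • q))) t =
      l * ∫ t in u..1, genInv (cdf (lawX κX x q)) t := by
  rw [lawX_smul, ← intervalIntegral.integral_const_mul]
  simp_rw [genInv_cdf_map_mul _ hl]

lemma superquantile_lawX_zero {u : ℝ} (hu : u ∈ Ioo (0 : ℝ) 1)
    (hX : Integrable (fun z : EuclideanSpace ℝ (Fin p) => z) (κX x)) :
    ∫ t in u..1, genInv (cdf (lawX κX x 0)) t ≤ 0 := by
  refine (superquantile_le (integrable_lawX hX) hu 0).trans ?_
  rw [integral_call_lawX]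
  simp

-- If `X^x'q = 0` almost surely, then `E(X^x X^x')q = E(X^x (X^x'q)) = 0`, so `q` lies in the kernel
-- of a nonsingular matrix.
omit [IsMarkovKernel κY] in
lemma not_ae_inner_eq_zero (hX2 : MemLp (fun z : EuclideanSpace ℝ (Fin p) => z) 2 (κX x))
    (hns : (condVarX κX x).det ≠ 0) (hq : q ≠ 0) :
    ¬ ∀ᵐ z ∂(κX x), inner ℝ (z - meanX κX x) q = 0 := fun h => by
  refine hns (Matrix.exists_mulVec_eq_zero_iff.1 ⟨q.ofLp, ?_, ?_⟩)
  · intro h0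
    exact hq (by ext i; simpa using congrFun h0 i)
  have hc : ∀ i, MemLp (fun z : EuclideanSpace ℝ (Fin p) => (z - meanX κX x) i) 2 (κX x) :=
    fun i => by
      have h1 : MemLp (fun z : EuclideanSpace ℝ (Fin p) => z - meanX κX x) 2 (κX x) :=
        hX2.sub (memLp_const _)
      refine h1.mono (by fun_prop) (ae_of_all _ fun z => ?_)
      exact PiLp.norm_apply_le _ i
  ext i
  simp only [Matrix.mulVec, dotProduct, condVarX, Matrix.of_apply, Pi.zero_apply]
  simp_rw [← integral_mul_const]
  have hi : ∀ j, Integrable (fun z : EuclideanSpace ℝ (Fin p) =>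
      (z - meanX κX x) i * (z - meanX κX x) j * q j) (κX x) := fun j =>
    ((hc i).integrable_mul (hc j)).mul_const _
  rw [← integral_finsetSum _ fun j _ => hi j]
  refine integral_eq_zero_of_ae ?_
  filter_upwards [h] with z hz
  simp only [Pi.zero_apply]
  have : ∑ j, (z - meanX κX x) i * (z - meanX κX x) j * q j =
      (z - meanX κX x) i * inner ℝ (z - meanX κX x) q := by
    rw [PiLp.inner_apply, Finset.mul_sum]
    refine Finset.sum_congr rfl fun j _ => ?_
    simp only [RCLike.inner_apply, conj_trivial]
    ring
  rw [this, hz, mul_zero]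

omit [IsMarkovKernel κY] in
lemma superquantile_lawX_pos (hX2 : MemLp (fun z : EuclideanSpace ℝ (Fin p) => z) 2 (κX x))
    (hns : (condVarX κX x).det ≠ 0) (hq : q ≠ 0) {u : ℝ} (hu : u ∈ Ioo (0 : ℝ) 1) :
    0 < ∫ t in u..1, genInv (cdf (lawX κX x q)) t := by
  have hX : Integrable (fun z : EuclideanSpace ℝ (Fin p) => z) (κX x) :=
    hX2.integrable (by norm_num)
  refine superquantile_pos (integrable_lawX hX) hu (integral_lawX hX) fun h => ?_
  exact not_ae_inner_eq_zero hX2 hns hq (ae_of_ae_map (by fun_prop) h)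

variable {T : Set (EuclideanSpace ℝ (Fin d))}

lemma radialSbar_nonneg (hY : ∀ x ∈ T, Integrable (fun y : ℝ => y) (κY x))
    (hX2 : ∀ x ∈ T, MemLp (fun z : EuclideanSpace ℝ (Fin p) => z) 2 (κX x))
    (hns : ∀ x ∈ T, (condVarX κX x).det ≠ 0) (hq : q ≠ 0) :
    0 ≤ radialSbar T κY κX q := by
  simp only [radialSbar, radialS, le_iInf_iff]
  intro x hx u hu
  exact EReal.coe_nonneg.2 (div_nonneg
    (superquantile_ge (integrable_lawY (hY x hx)) hu (integral_lawY (hY x hx)))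
    (superquantile_lawX_pos (hX2 x hx) (hns x hx) hq hu).le)

lemma le_radialSbar_iff (hY : ∀ x ∈ T, Integrable (fun y : ℝ => y) (κY x))
    (hX2 : ∀ x ∈ T, MemLp (fun z : EuclideanSpace ℝ (Fin p) => z) 2 (κX x))
    (hns : ∀ x ∈ T, (condVarX κX x).det ≠ 0) (hq : q ≠ 0) {l : ℝ} (hl : 0 ≤ l) :
    (l : EReal) ≤ radialSbar T κY κX q ↔ ∀ x ∈ T, ∀ u ∈ Ioo (0 : ℝ) 1,
      ∫ t in u..1, genInv (cdf (lawX κX x (l • q))) t ≤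
        ∫ t in u..1, genInv (cdf (lawY κY x)) t := by
  simp only [radialSbar, radialS, le_iInf_iff, EReal.coe_le_coe_iff]
  refine forall₄_congr fun x hx u hu => ?_
  have hpos := superquantile_lawX_pos (hX2 x hx) (hns x hx) hq hu
  have hY0 := superquantile_ge (integrable_lawY (hY x hx)) hu (integral_lawY (hY x hx))
  change l ≤ (∫ t in u..1, genInv (cdf (lawY κY x)) t) /
    (∫ t in u..1, genInv (cdf (lawX κX x q)) t) ↔ _
  rcases hl.eq_or_lt with rfl | hl
  · rw [zero_smul]
    exact iff_of_true (div_nonneg hY0 hpos.le)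
      ((superquantile_lawX_zero hu ((hX2 x hx).integrable (by norm_num))).trans hY0)
  · rw [superquantile_lawX_smul hl, le_div_iff₀ hpos]

end Radial

/-! ### Convexity, continuity and coercivity of the call functions -/

section Geometry

variable {d p : ℕ} {κY : Kernel (EuclideanSpace ℝ (Fin d)) ℝ}
  {κX : Kernel (EuclideanSpace ℝ (Fin d)) (EuclideanSpace ℝ (Fin p))}
  [IsMarkovKernel κX] {x : EuclideanSpace ℝ (Fin d)}

lemma convexOn_call (hX : Integrable (fun z : EuclideanSpace ℝ (Fin p) => z) (κX x)) (k : ℝ) :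
    ConvexOn ℝ univ fun β => ∫ y, max (y - k) 0 ∂(lawX κX x β) := by
  have hi : ∀ β, Integrable (fun z => max (inner ℝ (z - meanX κX x) β - k) 0) (κX x) := fun β =>
    (((hX.sub (integrable_const _)).inner_const β).sub (integrable_const k)).pos_part
  refine ⟨convex_univ, fun β _ γ _ a b ha hb hab => ?_⟩
  simp only [integral_call_lawX, smul_eq_mul]
  rw [← integral_const_mul, ← integral_const_mul,
    ← integral_add ((hi β).const_mul a) ((hi γ).const_mul b)]
  refine integral_mono (hi _) (((hi β).const_mul a).add ((hi γ).const_mul b)) fun z => ?_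
  simp only [inner_add_right, inner_smul_right]
  set s := inner ℝ (z - meanX κX x) β
  set t := inner ℝ (z - meanX κX x) γ
  have h1 := mul_le_mul_of_nonneg_left (le_max_left (s - k) 0) ha
  have h2 := mul_le_mul_of_nonneg_left (le_max_left (t - k) 0) hb
  have h3 := mul_nonneg ha (le_max_right (s - k) 0)
  have h4 := mul_nonneg hb (le_max_right (t - k) 0)
  refine max_le ?_ (by linarith)
  have : k = a * k + b * k := by rw [← add_mul, hab, one_mul]
  linarith

lemma continuous_call (hX : Integrable (fun z : EuclideanSpace ℝ (Fin p) => z) (κX x)) (k : ℝ) :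
    Continuous fun β => ∫ y, max (y - k) 0 ∂(lawX κX x β) :=
  continuousOn_univ.1 ((convexOn_call hX k).continuousOn isOpen_univ)

/-- Bounds on `E (X^x'β)⁺` bound `β`. -/
lemma isBounded_call_le (hX2 : MemLp (fun z : EuclideanSpace ℝ (Fin p) => z) 2 (κX x))
    (hns : (condVarX κX x).det ≠ 0) (C : ℝ) :
    Bornology.IsBounded
      {β : EuclideanSpace ℝ (Fin p) | ∫ y, max (y - 0) 0 ∂(lawX κX x β) ≤ C} := by
  have hX : Integrable (fun z : EuclideanSpace ℝ (Fin p) => z) (κX x) :=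
    hX2.integrable (by norm_num)
  set N : EuclideanSpace ℝ (Fin p) → ℝ := fun β => ∫ y, max (y - 0) 0 ∂(lawX κX x β) with hN
  have hpos : ∀ q, q ≠ 0 → 0 < N q := fun q hq => by
    -- Any level would do: the positive superquantile is at most the call at `k = 0`.
    have hu : (1 / 2 : ℝ) ∈ Ioo (0 : ℝ) 1 := by norm_num
    have h1 := superquantile_lawX_pos hX2 hns hq hu
    have h2 := superquantile_le (integrable_lawX (β := q) hX) hu 0
    rw [mul_zero, zero_add] at h2
    exact h1.trans_le h2
  have hhom : ∀ (l : ℝ) (q : EuclideanSpace ℝ (Fin p)), 0 ≤ l → N (l • q) = l * N q :=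
    fun l q hl => by
      simp only [hN, integral_call_lawX]
      simp only [inner_smul_right, sub_zero]
      rw [← integral_const_mul]
      refine integral_congr_ae (ae_of_all _ fun z => ?_)
      simp only
      rw [mul_max_of_nonneg _ _ hl, mul_zero]
  -- By homogeneity, `N β` is at least `‖β‖` times the minimum of `N` on the unit sphere; the sphere
  -- is empty when `p = 0`.
  rcases (Metric.sphere (0 : EuclideanSpace ℝ (Fin p)) 1).eq_empty_or_nonempty with he | hne
  · refine (Bornology.isBounded_singleton (x := (0 : EuclideanSpace ℝ (Fin p)))).subset
      fun β _ => ?_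
    by_contra hβ
    have hβ' : β ≠ 0 := hβ
    have : ‖β‖⁻¹ • β ∈ Metric.sphere (0 : EuclideanSpace ℝ (Fin p)) 1 := by
      rw [mem_sphere_zero_iff_norm, norm_smul, norm_inv, norm_norm,
        inv_mul_cancel₀ (norm_ne_zero_iff.2 hβ')]
    simp [he] at this
  · obtain ⟨q₀, hq₀, hmin⟩ := (isCompact_sphere (0 : EuclideanSpace ℝ (Fin p)) 1).exists_isMinOn
      hne (continuous_call hX 0).continuousOn
    have hq₀' : q₀ ≠ 0 := fun h => by simp [h] at hq₀
    have hδ := hpos q₀ hq₀'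
    refine (Metric.isBounded_closedBall (x := (0 : EuclideanSpace ℝ (Fin p)))
      (r := C / N q₀)).subset fun β hβ => ?_
    rw [mem_closedBall_zero_iff, le_div_iff₀ hδ]
    by_cases h0 : β = 0
    · subst h0
      have : N 0 ≤ C := hβ
      have h2 := hhom 0 0 le_rfl
      rw [zero_smul, zero_mul] at h2
      simp only [norm_zero, zero_mul]
      linarith
    · have hnorm : ‖β‖ ≠ 0 := norm_ne_zero_iff.2 h0
      have hmem : ‖β‖⁻¹ • β ∈ Metric.sphere (0 : EuclideanSpace ℝ (Fin p)) 1 := by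
        rw [mem_sphere_zero_iff_norm, norm_smul, norm_inv, norm_norm, inv_mul_cancel₀ hnorm]
      have h1 : N q₀ ≤ N (‖β‖⁻¹ • β) := hmin hmem
      rw [hhom _ _ (by positivity), inv_mul_eq_div, le_div_iff₀ (by positivity)] at h1
      rw [mul_comm]
      exact h1.trans hβ

end Geometry

/-! ### Characterizations of admissible pairs -/

section Identified

variable {d p : ℕ} {κY : Kernel (EuclideanSpace ℝ (Fin d)) ℝ} [IsMarkovKernel κY]
  {κX : Kernel (EuclideanSpace ℝ (Fin d)) (EuclideanSpace ℝ (Fin p))} [IsMarkovKernel κX]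
  {T : Set (EuclideanSpace ℝ (Fin d))} {β : EuclideanSpace ℝ (Fin p)}

/-- Compatibility with the model, in terms of call functions and in terms of superquantiles. -/
lemma compatible_tfae (hT : MeasurableSet T)
    (hY : ∀ x ∈ T, Integrable (fun y : ℝ => y) (κY x))
    (hX : ∀ x ∈ T, Integrable (fun z : EuclideanSpace ℝ (Fin p) => z) (κX x)) :
    List.TFAE [
      Compatible T κY κX β (fun x : T => meanY κY x - inner ℝ (meanX κX x) β),
      ∀ x ∈ T, ∀ k, ∫ y, max (y - k) 0 ∂(lawX κX x β) ≤ ∫ y, max (y - k) 0 ∂(lawY κY x),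
      ∀ x ∈ T, ∀ u ∈ Ioo (0 : ℝ) 1, ∫ t in u..1, genInv (cdf (lawX κX x β)) t ≤
        ∫ t in u..1, genInv (cdf (lawY κY x)) t] := by
  tfae_have 1 → 2 := fun h => (h.eq_and_call hY hX).2
  tfae_have 2 → 3 := fun h x hx u hu =>
    superquantile_mono (integrable_lawX (hX x hx)) (integrable_lawY (hY x hx)) (h x hx) hu
  tfae_have 3 → 1 := compatible_of_superquantile hT hY hX
  tfae_finish

variable {I : Type*} {D : Submodule ℝ (T → ℝ)} {R : D →ₗ[ℝ] (I → ℝ)} {c : I → ℝ}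

omit [IsMarkovKernel κY] [IsMarkovKernel κX] in
lemma satisfiesShape_iff (hmY : (fun x : T => meanY κY x) ∈ D)
    (hmX : ∀ q : EuclideanSpace ℝ (Fin p), (fun x : T => (inner ℝ (meanX κX x) q : ℝ)) ∈ D) :
    SatisfiesShape D R c (fun x : T => meanY κY x - inner ℝ (meanX κX x) β) ↔
      ∀ r, R ⟨_, hmX β⟩ r ≤ (R ⟨_, hmY⟩ - c) r := by
  have hR : ∀ hf, R ⟨fun x : T => meanY κY x - inner ℝ (meanX κX x) β, hf⟩ =
      R ⟨_, hmY⟩ - R ⟨_, hmX β⟩ := fun hf => by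
    rw [← map_sub]; rfl
  constructor
  · rintro ⟨hf, h⟩ r
    have := h r
    rw [hR, Pi.sub_apply] at this
    rw [Pi.sub_apply]
    linarith
  · refine fun h => ⟨D.sub_mem hmY (hmX β), fun r => ?_⟩
    have := h r
    rw [Pi.sub_apply] at this
    rw [hR, Pi.sub_apply]
    linarith

lemma compatible_and_shape_iff (hT : MeasurableSet T)
    (hY : ∀ x ∈ T, Integrable (fun y : ℝ => y) (κY x))
    (hX : ∀ x ∈ T, Integrable (fun z : EuclideanSpace ℝ (Fin p) => z) (κX x))
    (hmY : (fun x : T => meanY κY x) ∈ D)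
    (hmX : ∀ q : EuclideanSpace ℝ (Fin p), (fun x : T => (inner ℝ (meanX κX x) q : ℝ)) ∈ D)
    (f : T → ℝ) :
    (Compatible T κY κX β f ∧ SatisfiesShape D R c f) ↔
      f = (fun x : T => meanY κY x - inner ℝ (meanX κX x) β) ∧
      (∀ x ∈ T, ∀ k, ∫ y, max (y - k) 0 ∂(lawX κX x β) ≤ ∫ y, max (y - k) 0 ∂(lawY κY x)) ∧
      ∀ r, R ⟨_, hmX β⟩ r ≤ (R ⟨_, hmY⟩ - c) r := by
  constructor
  · rintro ⟨h1, h2⟩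
    obtain ⟨rfl, h3⟩ := h1.eq_and_call hY hX
    exact ⟨rfl, h3, (satisfiesShape_iff hmY hmX).1 h2⟩
  · rintro ⟨rfl, h1, h2⟩
    exact ⟨((compatible_tfae hT hY hX).out 0 1).2 h1, (satisfiesShape_iff hmY hmX).2 h2⟩

lemma exists_eq_smul_unit [NeZero p] (β : EuclideanSpace ℝ (Fin p)) :
    ∃ (q : EuclideanSpace ℝ (Fin p)) (l : ℝ), ‖q‖ = 1 ∧ 0 ≤ q 0 ∧ β = l • q := by
  by_cases h0 : β = 0
  · exact ⟨EuclideanSpace.single 0 1, 0, by simp, by simp, by simp [h0]⟩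
  have hnorm : ‖β‖ ≠ 0 := norm_ne_zero_iff.2 h0
  rcases le_total 0 (β 0) with h | h
  · refine ⟨‖β‖⁻¹ • β, ‖β‖, ?_, ?_, ?_⟩
    · rw [norm_smul, norm_inv, norm_norm, inv_mul_cancel₀ hnorm]
    · exact mul_nonneg (by positivity) h
    · rw [smul_smul, mul_inv_cancel₀ hnorm, one_smul]
  · refine ⟨(-‖β‖⁻¹) • β, -‖β‖, ?_, ?_, ?_⟩
    · rw [norm_smul, norm_neg, norm_inv, norm_norm, inv_mul_cancel₀ hnorm]
    · exact mul_nonneg_of_nonpos_of_nonpos (by simp) h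
    · rw [smul_smul, neg_mul_neg, mul_inv_cancel₀ hnorm, one_smul]

/-- The radial description of the compatible vectors `l • q`. -/
lemma radial_iff (hY : ∀ x ∈ T, Integrable (fun y : ℝ => y) (κY x))
    (hX2 : ∀ x ∈ T, MemLp (fun z : EuclideanSpace ℝ (Fin p) => z) 2 (κX x))
    (hns : ∀ x ∈ T, (condVarX κX x).det ≠ 0) {q : EuclideanSpace ℝ (Fin p)} (hq : q ≠ 0) (l : ℝ) :
    (-radialSbar T κY κX (-q) ≤ (l : EReal) ∧ (l : EReal) ≤ radialSbar T κY κX q) ↔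
      ∀ x ∈ T, ∀ u ∈ Ioo (0 : ℝ) 1, ∫ t in u..1, genInv (cdf (lawX κX x (l • q))) t ≤
        ∫ t in u..1, genInv (cdf (lawY κY x)) t := by
  have hq' : -q ≠ 0 := neg_ne_zero.2 hq
  rw [EReal.neg_le, ← EReal.coe_neg]
  -- Since `S̄` is nonnegative at both `q` and `-q`, only the bound on the side of the sign of `l`
  -- is active; for `l ≤ 0`, `l • q = (-l) • (-q)`.
  rcases le_total 0 l with hl | hl
  · rw [← le_radialSbar_iff hY hX2 hns hq hl, and_iff_right_iff_imp]
    intro _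
    exact (EReal.coe_nonpos.2 (by linarith)).trans (radialSbar_nonneg hY hX2 hns hq')
  · have := le_radialSbar_iff hY hX2 hns hq' (neg_nonneg.2 hl)
    rw [smul_neg, neg_smul, neg_neg] at this
    rw [← this, and_iff_left_iff_imp]
    intro _
    exact (EReal.coe_nonpos.2 hl).trans (radialSbar_nonneg hY hX2 hns hq)

end Identified

end DataCombination

/-! ### The identified sets -/

open DataCombination in
theorem proposition3 {Ω : Type*} [MeasurableSpace Ω] (P : Measure Ω) [IsProbabilityMeasure P]
    {d p : ℕ} [NeZero p]
    (Y : Ω → ℝ) (Xnc : Ω → EuclideanSpace ℝ (Fin p)) (Xc : Ω → EuclideanSpace ℝ (Fin d))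
    (hY : Measurable Y) (hXnc : Measurable Xnc) (hXc : Measurable Xc)
    -- versions of the laws of `Y` and of `X_nc` given `X_c = x`
    (κY : Kernel (EuclideanSpace ℝ (Fin d)) ℝ) [IsMarkovKernel κY]
    (κX : Kernel (EuclideanSpace ℝ (Fin d)) (EuclideanSpace ℝ (Fin p))) [IsMarkovKernel κX]
    (hκY : HasCondDistrib Y Xc κY P) (hκX : HasCondDistrib Xnc Xc κX P)
    -- moment conditions
    (hY2 : MemLp Y 2 P)
    (hY1 : ∀ x ∈ (P.map Xc).support, Integrable (fun y : ℝ => y) (κY x))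
    (hX2 : ∀ x ∈ (P.map Xc).support, MemLp (fun z : EuclideanSpace ℝ (Fin p) => z) 2 (κX x))
    (hXns : ∀ x ∈ (P.map Xc).support, (condVarX κX x).det ≠ 0)
    -- the linear shape restrictions `[R f](r) ≥ c r`
    {I : Type*} (D : Submodule ℝ ((P.map Xc).support → ℝ)) (R : D →ₗ[ℝ] (I → ℝ)) (c : I → ℝ)
    (hmY : (fun x : (P.map Xc).support => meanY κY x) ∈ D)
    (hmX : ∀ q : EuclideanSpace ℝ (Fin p),
      (fun x : (P.map Xc).support => (inner ℝ (meanX κX x) q : ℝ)) ∈ D) :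
    identifiedBeta (P.map Xc).support κY κX D R c =
        {β | ∃ (q : EuclideanSpace ℝ (Fin p)) (l : ℝ), ‖q‖ = 1 ∧ 0 ≤ q 0 ∧
          max (-radialSbar (P.map Xc).support κY κX (-q))
              (lowerSc (R ⟨_, hmY⟩ - c) (R ⟨_, hmX q⟩)) ≤ (l : EReal) ∧
          (l : EReal) ≤ min (radialSbar (P.map Xc).support κY κX q)
              (upperSc (R ⟨_, hmY⟩ - c) (R ⟨_, hmX q⟩)) ∧
          β = l • q} ∧
      identifiedF (P.map Xc).support κY κX D R c =
        {f | ∃ β ∈ identifiedBeta (P.map Xc).support κY κX D R c,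
          f = fun x : (P.map Xc).support => meanY κY x - inner ℝ (meanX κX x) β} ∧
      IsCompact (identifiedBeta (P.map Xc).support κY κX D R c) ∧
      Convex ℝ (identifiedBeta (P.map Xc).support κY κX D R c) ∧
      ((∃ r, (R ⟨_, hmY⟩ - c) r < 0) →
        (0 : EuclideanSpace ℝ (Fin p)) ∉ identifiedBeta (P.map Xc).support κY κX D R c) := by
  have hP : IsProbabilityMeasure (P.map Xc) := Measure.isProbabilityMeasure_map hXc.aemeasurable
  have hTne : (P.map Xc).support.Nonempty :=
    Measure.nonempty_support (IsProbabilityMeasure.ne_zero _)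
  have hT : MeasurableSet (P.map Xc).support := Measure.isClosed_support.measurableSet
  generalize (P.map Xc).support = T at *
  have hX1 : ∀ x ∈ T, Integrable (fun z : EuclideanSpace ℝ (Fin p) => z) (κX x) := fun x hx =>
    (hX2 x hx).integrable (by norm_num)
  have hiff := fun (β : EuclideanSpace ℝ (Fin p)) (f : T → ℝ) =>
    compatible_and_shape_iff (R := R) (c := c) (β := β) hT hY1 hX1 hmY hmX f
  set a : I → ℝ := R ⟨_, hmY⟩ - c with ha
  -- Linearity in `q` turns the shape restrictions into half-spaces, and finite dimension makes each
  -- coordinate continuous.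
  set L : EuclideanSpace ℝ (Fin p) →ₗ[ℝ] (I → ℝ) :=
    { toFun := fun q => R ⟨_, hmX q⟩
      map_add' := fun q q' => by
        rw [← map_add]
        congr 2
        ext x
        simp [inner_add_right]
      map_smul' := fun l q => by
        rw [RingHom.id_apply, ← map_smul]
        congr 2
        ext x
        simp [inner_smul_right] } with hL
  have hLq : ∀ q, R ⟨_, hmX q⟩ = L q := fun q => rfl
  -- The call form has a right-hand side free of `β`, from which closedness, boundedness and
  -- convexity are read off.
  have hB : identifiedBeta T κY κX D R c = {β | (∀ x ∈ T, ∀ k,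
      ∫ y, max (y - k) 0 ∂(lawX κX x β) ≤ ∫ y, max (y - k) 0 ∂(lawY κY x)) ∧
      ∀ r, L β r ≤ a r} := by
    ext β
    simp only [identifiedBeta, mem_ofPred_eq, hiff, exists_eq_left]
    rfl
  refine ⟨?_, ?_, ?_, ?_, ?_⟩
  · have hrad : ∀ (q : EuclideanSpace ℝ (Fin p)) (l : ℝ), ‖q‖ = 1 →
        (max (-radialSbar T κY κX (-q)) (lowerSc a (L q)) ≤ (l : EReal) ∧
          (l : EReal) ≤ min (radialSbar T κY κX q) (upperSc a (L q)) ↔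
        l • q ∈ identifiedBeta T κY κX D R c) := fun q l hq => by
      have hq0 : q ≠ 0 := fun h => by simp [h] at hq
      have h12 := (compatible_tfae (κY := κY) (κX := κX) (β := l • q) hT hY1 hX1).out 1 2
      rw [max_le_iff, le_min_iff, and_and_and_comm, radial_iff hY1 hX2 hXns hq0,
        lowerSc_le_and_le_upperSc_iff, hB, mem_ofPred_eq, h12]
      simp only [map_smul, Pi.smul_apply, smul_eq_mul]
    ext β
    constructor
    · intro hβ
      obtain ⟨q, l, hq, hq0, rfl⟩ := exists_eq_smul_unit β
      obtain ⟨h1, h2⟩ := (hrad q l hq).2 hβ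
      exact ⟨q, l, hq, hq0, h1, h2, rfl⟩
    · rintro ⟨q, l, hq, hq0, h1, h2, rfl⟩
      exact (hrad q l hq).1 ⟨h1, h2⟩
  · ext f
    simp only [identifiedF, identifiedBeta, mem_ofPred_eq, hiff]
    constructor
    · rintro ⟨β, h1, h2⟩
      exact ⟨β, ⟨_, rfl, h2⟩, h1⟩
    · rintro ⟨β, ⟨_, _, h2⟩, h1⟩
      exact ⟨β, h1, h2⟩
  · obtain ⟨x₀, hx₀⟩ := hTne
    refine Metric.isCompact_of_isClosed_isBounded ?_ ?_
    · rw [hB]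
      have h1 : IsClosed {β : EuclideanSpace ℝ (Fin p) | ∀ x ∈ T, ∀ k : ℝ,
          ∫ y, max (y - k) 0 ∂(lawX κX x β) ≤ ∫ y, max (y - k) 0 ∂(lawY κY x)} := by
        simp only [ofPred_forall]
        exact isClosed_iInter fun x => isClosed_iInter fun hx => isClosed_iInter fun k =>
          isClosed_le (continuous_call (hX1 x hx) k) continuous_const
      have h2 : IsClosed {β : EuclideanSpace ℝ (Fin p) | ∀ r, L β r ≤ a r} := by
        simp only [ofPred_forall]
        exact isClosed_iInter fun r => isClosed_le
          ((LinearMap.proj r).comp L).continuous_of_finiteDimensional continuous_const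
      exact h1.inter h2
    · refine (isBounded_call_le (hX2 x₀ hx₀) (hXns x₀ hx₀)
        (∫ y, max (y - 0) 0 ∂(lawY κY x₀))).subset fun β hβ => ?_
      rw [hB] at hβ
      exact hβ.1 x₀ hx₀ 0
  · rw [hB]
    rintro β ⟨hβ1, hβ2⟩ γ ⟨hγ1, hγ2⟩ s t hs ht hst
    refine ⟨fun x hx k => ?_, fun r => ?_⟩
    · refine ((convexOn_call (hX1 x hx) k).2 (mem_univ β) (mem_univ γ) hs ht hst).trans ?_
      simp only [smul_eq_mul]
      calc _ ≤ s * ∫ y, max (y - k) 0 ∂(lawY κY x) + t * ∫ y, max (y - k) 0 ∂(lawY κY x) :=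
            add_le_add (mul_le_mul_of_nonneg_left (hβ1 x hx k) hs)
              (mul_le_mul_of_nonneg_left (hγ1 x hx k) ht)
        _ = _ := by rw [← add_mul, hst, one_mul]
    · rw [map_add, map_smul, map_smul]
      simp only [Pi.add_apply, Pi.smul_apply, smul_eq_mul]
      calc _ ≤ s * a r + t * a r :=
            add_le_add (mul_le_mul_of_nonneg_left (hβ2 r) hs)
              (mul_le_mul_of_nonneg_left (hγ2 r) ht)
        _ = _ := by rw [← add_mul, hst, one_mul]
  · rintro ⟨r, hr⟩ h0
    rw [hB] at h0
    have := h0.2 r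
    rw [map_zero, Pi.zero_apply] at this
    linarith
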